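/- Work over $\mathbb{C}(q)$, fix $\iota=\sqrt{-1}\in\mathbb{C}$, and for $n\in\mathbb{Z}$, $\mu\in\mathbb{C}(q)^*$ put $[n]=\frac{q^n-q^{-n}}{q-q^{-1}}$ and $[\mu;n]=\frac{q^n\mu-q^{-n}\mu^{-1}}{q-q^{-1}}$. Let $U_q'=U_q'(\mathfrak{gl}_2\times\mathfrak{gl}_2)$ be the quantum symmetric pair coideal subalgebra of $U_q(\mathfrak{gl}_4)$, presented as the $\mathbb{C}(q)$-algebra with generators $B_0,B_1,B_{-1},\hat D_\diamondsuit^{\pm1},\hat D_1^{\pm1}$ and the following relations: $\hat D_\diamondsuit,\hat D_1$ are invertible (with inverses $\hat D_\diamondsuit^{-1},\hat D_1^{-1}$) and commute with each other and with $B_0$; $$\hat D_\diamondsuit B_{\pm1}=q^{\pm1}B_{\pm1}\hat D_\diamondsuit,\qquad \hat D_1B_{\pm1}=q^{\mp1}B_{\pm1}\hat D_1,\qquad B_1B_{-1}-B_{-1}B_1=\frac{\hat D_\diamondsuit\hat D_1^{-1}-\hat D_1\hat D_\diamondsuit^{-1}}{q-q^{-1}},$$ $$B_0^2B_{\pm1}-[2]B_0B_{\pm1}B_0+B_{\pm1}B_0^2=B_{\pm1},\qquad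 B_{\pm1}^2B_0-[2]B_{\pm1}B_0B_{\pm1}+B_0B_{\pm1}^2=0.$$ Put $X=B_0B_1-q^{-1}B_1B_0$, $Y=B_0B_{-1}-q^{-1}B_{-1}B_0$, $Z=B_1Y-q^{-1}YB_1$. For $\kappa_\diamondsuit,\kappa_1\in\mathbb{Z}$ and $\beta,\zeta\in\mathbb{C}(q)$ let $\mathbb{M}(\kappa_\diamondsuit,\kappa_1,\beta,\zeta)$ be the Verma module, i.e. the left $U_q'$-module induced from the one-dimensional representation of the subalgebra generated by $B_1,X,\hat D_\diamondsuit^{\pm1},\hat D_1^{\pm1},B_0,Z$ on which $B_1,X$ act by $0$ and $\hat D_\diamondsuit,\hat D_1,B_0,Z$ act by $q^{\kappa_\diamondsuit},q^{\kappa_1},\beta,\zeta$. **Theorem.** Let $\mu,\mu'\in\mathbb{C}(q)^*$, $\zeta,\zeta'\in\mathbb{C}(q)$ and $\kappa_\diamondsuit,\kappa_1,\kappa_\diamondsuit',\kappa_1'\in\mathbb{Z}$, put $\kappa=\kappa_\diamondsuit-\kappa_1$, and suppose that $M=\mathbb{M}(\kappa_\diamondsuit,\kappa_1,[\mu;0],\zeta)$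 is good, i.e. $\mu\ne\pm q^l\iota$ for all $l\in\mathbb{Z}$. Then $\operatorname{Hom}_{U_q'}(\mathbb{M}(\kappa_\diamondsuit',\kappa_1',[\mu';0],\zeta'),M)$ is nonzero if and only if there exists $i\in\mathbb{Z}_{\ge0}$ such that one of the following holds: 1. $\zeta=\mu q^{-i}[\kappa-i]-\mu^{-1}q^{i-\kappa}[i]$, $\kappa_\diamondsuit'=\kappa_\diamondsuit-i-1$, $\kappa_1'=\kappa_1+i+1$, $[\mu';0]=[\mu;-(i+1)]$, $\zeta'=\mu q[\kappa-i]+\mu^{-1}q^{2i+1-\kappa}[i+2]$; 2. $\zeta=\mu q^{i-\kappa}[i]-\mu^{-1}q^{-i}[\kappa-i]$, $\kappa_\diamondsuit'=\kappa_\diamondsuit-i-1$, $\kappa_1'=\kappa_1+i+1$, $[\mu';0]=[\mu;i+1]$, $\zeta'=-\mu q^{2i+1-\kappa}[i+2]-\mu^{-1}q[\kappa-i]$; 3. $0\le i\le\kappa$, $\zeta=\mu q^{-i}[\kappa-i]-\mu^{-1}q^{i-\kappa}[i]$, $\kappa_\diamondsuit'=\kappa_1-2$, $\kappa_1'=\kappa_\diamondsuit+2$,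 $[\mu';0]=[\mu;\kappa-2i]$, $\zeta'=\mu^{-1}q^{i+2}[i+2]-\mu q^{\kappa-i+2}[\kappa-i+2]$; 4. $(\kappa_\diamondsuit',\kappa_1',[\mu';0],\zeta')=(\kappa_\diamondsuit,\kappa_1,[\mu;0],\zeta)$. If this Hom space is nonzero, it is one-dimensional over $\mathbb{C}(q)$. -/

import Mathlib

noncomputable section

namespace QSP

/-- The ground field `ℂ(q)`. -/
abbrev Kq : Type := RatFunc ℂ

/-- The variable `q` of `ℂ(q)`. -/
def q : Kq := RatFunc.X

/-- The chosen square root `ι` of `-1`, as a constant of `ℂ(q)`. -/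
def iota : Kq := RatFunc.C Complex.I

/-- The quantum integer `[n] = (q^n - q^{-n}) / (q - q^{-1})` for `n : ℤ`. -/
def qint (n : ℤ) : Kq := (q ^ n - q ^ (-n)) / (q - q⁻¹)

/-- `[μ; n] = (q^n μ - q^{-n} μ⁻¹) / (q - q^{-1})`, meant for `μ ≠ 0`. -/
def qbr (μ : Kq) (n : ℤ) : Kq := (q ^ n * μ - q ^ (-n) * μ⁻¹) / (q - q⁻¹)

/-- Generators of `U_q'`: `b0, b1, bm1` stand for `B_0, B_1, B_{-1}`, `dd, ddInv` for
`D̂_◇, D̂_◇⁻¹` and `d1, d1Inv` for `D̂_1, D̂_1⁻¹`. -/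
inductive Gen : Type
  | b0 | b1 | bm1 | dd | ddInv | d1 | d1Inv

/-- The free associative algebra on the generators. -/
abbrev Free : Type := FreeAlgebra Kq Gen

/-- A generator as an element of the free algebra. -/
abbrev gen (g : Gen) : Free := FreeAlgebra.ι Kq g

open Gen in
/-- The defining relations of `U_q'`. With `K̂ = D̂_◇ D̂_1⁻¹`, the elements `B_1, B_{-1}, D̂_◇, D̂_1`
satisfy the relations of `U_q(gl_2)`, with `B_1` in the role of `E` and `B_{-1}` in the role of `F`;
`B_0` commutes with `D̂_◇, D̂_1`; and `B_0, B_{±1}` satisfy the (inhomogeneous) quantum Serre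
relations. -/
inductive Rel : Free → Free → Prop
  | dd_inv : Rel (gen dd * gen ddInv) 1
  | inv_dd : Rel (gen ddInv * gen dd) 1
  | d1_inv : Rel (gen d1 * gen d1Inv) 1
  | inv_d1 : Rel (gen d1Inv * gen d1) 1
  | dd_d1 : Rel (gen dd * gen d1) (gen d1 * gen dd)
  | dd_b1 : Rel (gen dd * gen b1) (q • (gen b1 * gen dd))
  | dd_bm1 : Rel (gen dd * gen bm1) (q⁻¹ • (gen bm1 * gen dd))
  | d1_b1 : Rel (gen d1 * gen b1) (q⁻¹ • (gen b1 * gen d1))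
  | d1_bm1 : Rel (gen d1 * gen bm1) (q • (gen bm1 * gen d1))
  | dd_b0 : Rel (gen dd * gen b0) (gen b0 * gen dd)
  | d1_b0 : Rel (gen d1 * gen b0) (gen b0 * gen d1)
  | b1_bm1 : Rel (gen b1 * gen bm1 - gen bm1 * gen b1)
      ((q - q⁻¹)⁻¹ • (gen dd * gen d1Inv - gen d1 * gen ddInv))
  | serre_b0_b1 : Rel
      (gen b0 * gen b0 * gen b1 - qint 2 • (gen b0 * gen b1 * gen b0) + gen b1 * gen b0 * gen b0)
      (gen b1)
  | serre_b0_bm1 : Rel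
      (gen b0 * gen b0 * gen bm1 - qint 2 • (gen b0 * gen bm1 * gen b0)
        + gen bm1 * gen b0 * gen b0)
      (gen bm1)
  | serre_b1_b0 : Rel
      (gen b1 * gen b1 * gen b0 - qint 2 • (gen b1 * gen b0 * gen b1) + gen b0 * gen b1 * gen b1)
      0
  | serre_bm1_b0 : Rel
      (gen bm1 * gen bm1 * gen b0 - qint 2 • (gen bm1 * gen b0 * gen bm1)
        + gen b0 * gen bm1 * gen bm1)
      0

/-- The quantum symmetric pair algebra `U_q' = U_q'(gl_2 × gl_2)`, by its presentation. -/
abbrev Uq' : Type := RingQuot Rel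

/-- The image of a generator in `U_q'`. -/
def u (g : Gen) : Uq' := RingQuot.mkAlgHom Kq Rel (gen g)

def B0 : Uq' := u Gen.b0
def B1 : Uq' := u Gen.b1
def Bm1 : Uq' := u Gen.bm1
/-- `D̂_◇`. -/
def Dd : Uq' := u Gen.dd
/-- `D̂_1`. -/
def D1 : Uq' := u Gen.d1

/-- The `p`-commutator `[A, B]_p = A B - p B A`. -/
def qcomm (p : Kq) (A B : Uq') : Uq' := A * B - p • (B * A)

/-- `X = [B_0, B_1]_{q⁻¹}`. -/
def X : Uq' := qcomm q⁻¹ B0 B1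
/-- `Y = [B_0, B_{-1}]_{q⁻¹}`. -/
def Y : Uq' := qcomm q⁻¹ B0 Bm1
/-- `Z = [B_1, Y]_{q⁻¹}`. -/
def Z : Uq' := qcomm q⁻¹ B1 Y

/-- The left ideal of `U_q'` generated by `B_1`, `X`, `D̂_◇ - q^κ_◇`, `D̂_1 - q^κ_1`, `B_0 - β`
and `Z - ζ`. -/
def vermaIdeal (κd κ1 : ℤ) (β ζ : Kq) : Submodule Uq' Uq' :=
  Submodule.span Uq'
    {B1, X, Dd - algebraMap Kq Uq' (q ^ κd), D1 - algebraMap Kq Uq' (q ^ κ1),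
      B0 - algebraMap Kq Uq' β, Z - algebraMap Kq Uq' ζ}

/-- The Verma module `M(κ_◇, κ_1, β, ζ)`: the left `U_q'`-module induced from the one-dimensional
representation of the subalgebra generated by `B_1, X, D̂_◇^{±1}, D̂_1^{±1}, B_0, Z` on which these
generators act by `0, 0, q^{±κ_◇}, q^{±κ_1}, β, ζ`. Since `A / J` induces to `U_q' / U_q' J` for a
left ideal `J` of a subalgebra `A`, it is the quotient of `U_q'` by the left ideal above; the
highest weight vector `1 ⊗ 1` is the class of `1`. -/
abbrev Verma (κd κ1 : ℤ) (β ζ : Kq) : Type :=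
  Uq' ⧸ vermaIdeal κd κ1 β ζ

/-- The condition on `μ` (nonzero) under which `M(κ_◇, κ_1, [μ;0], ζ)` is a good Verma module. -/
def IsGood (μ : Kq) : Prop :=
  ∀ l : ℤ, μ ≠ q ^ l * iota ∧ μ ≠ -(q ^ l * iota)

/-- `Hom_{U_q'}` between two Verma modules; a vector space over `ℂ(q)`. -/
abbrev VermaHom (κd' κ1' : ℤ) (β' ζ' : Kq) (κd κ1 : ℤ) (β ζ : Kq) : Type :=
  Verma κd' κ1' β' ζ' →ₗ[Uq'] Verma κd κ1 β ζ

end QSP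

end

/-!
For `x` of `B_0`-weight `[μ; n]`, the Serre relations split `qplus μ n • B_{-1} x`, where
`qplus μ n = [μ; n + 1] - [μ; n - 1]`, into a part of weight `[μ; n + 1]` (raising) and a part of
weight `[μ; n - 1]` (lowering), and the two operations commute. Goodness says exactly that
`qplus μ n` never vanishes, so the vectors obtained from the highest weight vector by `a` raising
and `b` lowering steps span `M`; mapping `M` to an explicit representation with basis `W a b`,
`a b : ℤ`, shows that they are independent. Their weights are pairwise distinct, again by goodness,
so a homomorphism to `M` is determined up to a scalar by the `(a, b)` for which it hits a multiple
of `W a b`, and it remains to find the singular `W a b`. There `B_1 W a b` has coordinates at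
`W (a - 1) b` and `W a (b - 1)`, which vanish, for `a, b > 0`, exactly when `ζ` is the value
`singularZeta` at `κ - (a - 1)` and at `b - 1` respectively. The four cases of the theorem are
`a = 0 < b`, `b = 0 < a`, `0 < a, b` and `a = b = 0`.
-/

namespace QSP

noncomputable section

-- Tactics such as `module` look for these structures on `Kq`, not for those of `RatFunc`.
attribute [local instance] Semiring.toNatAlgebra Ring.toIntAlgebra

theorem q_ne_zero : q ≠ 0 := RatFunc.X_ne_zero

theorem intDegree_zpow {x : Kq} (hx : x ≠ 0) (n : ℤ) :
    (x ^ n).intDegree = n * x.intDegree := by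
  have hnat : ∀ m : ℕ, (x ^ m).intDegree = m * x.intDegree := by
    intro m
    induction m with
    | zero => simp
    | succ k ih =>
      rw [pow_succ, RatFunc.intDegree_mul (pow_ne_zero _ hx) hx, ih]
      push_cast
      ring
  obtain ⟨m, rfl | rfl⟩ := n.eq_nat_or_neg
  · simpa using hnat m
  · rw [zpow_neg, zpow_natCast, RatFunc.intDegree_inv, hnat, neg_mul]

theorem intDegree_q_zpow (n : ℤ) : (q ^ n).intDegree = n := by
  rw [intDegree_zpow q_ne_zero, q, RatFunc.intDegree_X, mul_one]

theorem q_zpow_injective : Function.Injective fun n : ℤ => q ^ n :=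
  Function.LeftInverse.injective (g := RatFunc.intDegree) intDegree_q_zpow

theorem q_sq_sub_one_ne_zero : q ^ 2 - 1 ≠ 0 := fun h => by
  have : (2 : ℤ) = 0 := q_zpow_injective (by simpa [sub_eq_zero] using h)
  omega

theorem q_sub_inv_ne_zero : q - q⁻¹ ≠ 0 := fun h => by
  have hq := q_ne_zero
  field_simp at h
  exact q_sq_sub_one_ne_zero (by simpa using h)

theorem qint_zero : qint 0 = 0 := by simp [qint]

theorem qint_one : qint 1 = 1 := by
  rw [qint, zpow_neg, zpow_one, div_self q_sub_inv_ne_zero]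

theorem qint_ne_zero {n : ℤ} (hn : n ≠ 0) : qint n ≠ 0 := by
  refine div_ne_zero (fun h => hn ?_) q_sub_inv_ne_zero
  have := q_zpow_injective (sub_eq_zero.mp h)
  omega

/-- The symmetric companion `q^n μ + q^{-n} μ⁻¹` of `[μ; n]`, equal to `[μ; n + 1] - [μ; n - 1]`. -/
def qplus (μ : Kq) (n : ℤ) : Kq := q ^ n * μ + q ^ (-n) * μ⁻¹

theorem qplus_neg_inv (μ : Kq) (n : ℤ) : qplus (-μ⁻¹) n = -qplus μ (-n) := by
  simp only [qplus, inv_neg (R := Kq), inv_inv, neg_neg]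
  ring

theorem qbr_add_one_sub (μ : Kq) (n : ℤ) : qbr μ (n + 1) - qbr μ (n - 1) = qplus μ n := by
  have hq := q_ne_zero
  have h := q_sq_sub_one_ne_zero
  simp only [qbr, qplus, neg_add, neg_sub, zpow_add₀ hq, zpow_sub₀ hq, zpow_neg, zpow_one]
  field_simp
  ring

theorem qbr_add_one_add (μ : Kq) (n : ℤ) :
    qbr μ (n + 1) + qbr μ (n - 1) = qint 2 * qbr μ n := by
  have hq := q_ne_zero
  have h := q_sq_sub_one_ne_zero
  simp only [qbr, qint, zpow_add₀ hq, zpow_sub₀ hq, zpow_neg, zpow_ofNat]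
  field_simp
  ring

theorem qbr_add_one_mul_sub_one {μ : Kq} (hμ : μ ≠ 0) (n : ℤ) :
    qbr μ (n + 1) * qbr μ (n - 1) = qbr μ n ^ 2 - 1 := by
  have hq := q_ne_zero
  have h := q_sq_sub_one_ne_zero
  simp only [qbr, zpow_add₀ hq, zpow_sub₀ hq, zpow_neg, zpow_one]
  field_simp
  ring

theorem qbr_add_one_sub_qinv_mul (μ : Kq) (n : ℤ) :
    qbr μ (n + 1) - q⁻¹ * qbr μ n = q ^ n * μ := by
  have hq := q_ne_zero
  have h := q_sq_sub_one_ne_zero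
  simp only [qbr, zpow_add₀ hq, zpow_neg, zpow_one]
  generalize μ⁻¹ = ν
  field_simp
  ring

theorem IsGood.sq_ne {μ : Kq} (hμ : μ ≠ 0) (h : IsGood μ) (m : ℤ) : μ ^ 2 ≠ -q ^ m := by
  intro e
  have hdeg : m = μ.intDegree + μ.intDegree := by
    rw [← RatFunc.intDegree_mul hμ hμ, ← pow_two, e, RatFunc.intDegree_neg, intDegree_q_zpow]
  have hsq : μ ^ 2 = (q ^ μ.intDegree * iota) ^ 2 := by
    rw [e, mul_pow, iota, ← map_pow, Complex.I_sq, map_neg, map_one, hdeg, zpow_add₀ q_ne_zero]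
    ring
  rcases sq_eq_sq_iff_eq_or_eq_neg.mp hsq with h1 | h1
  · exact (h _).1 h1
  · exact (h _).2 h1

theorem qplus_ne_zero {μ : Kq} (hμ : μ ≠ 0) (h : IsGood μ) (n : ℤ) : qplus μ n ≠ 0 := by
  intro e
  apply h.sq_ne hμ (-n - n)
  have hq := q_ne_zero
  rw [qplus, zpow_neg] at e
  rw [zpow_sub₀ hq, zpow_neg]
  field_simp at e ⊢
  linear_combination e

theorem qbr_injective {μ : Kq} (hμ : μ ≠ 0) (h : IsGood μ) : Function.Injective (qbr μ) := by
  intro m n e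
  by_contra hne
  apply h.sq_ne hμ (-m - n)
  have hq := q_ne_zero
  have hmn : q ^ m - q ^ n ≠ 0 := sub_ne_zero.mpr (q_zpow_injective.ne hne)
  rw [qbr, qbr, div_left_inj' q_sub_inv_ne_zero, zpow_neg, zpow_neg] at e
  rw [zpow_sub₀ hq, zpow_neg]
  field_simp at e ⊢
  refine mul_left_cancel₀ hmn ?_
  linear_combination e

/-- The value of `ζ` for which the `(i+1)`-st descendant in the direction lowering the
`B_0`-weight `[μ; n]` to `[μ; n - 1]` is singular. Since `[-μ⁻¹; n] = [μ; -n]`, the value for the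
raising direction is `singularZeta κ (-μ⁻¹) i`. -/
def singularZeta (κ : ℤ) (μ : Kq) (i : ℤ) : Kq :=
  μ * q ^ (-i) * qint (κ - i) - μ⁻¹ * q ^ (i - κ) * qint i

theorem singularZeta_neg_inv (κ : ℤ) (μ : Kq) (i : ℤ) :
    singularZeta κ (-μ⁻¹) i = singularZeta κ μ (κ - i) := by
  simp only [singularZeta, inv_neg (R := Kq), inv_inv, neg_sub, sub_sub_cancel, sub_sub_cancel_left]
  ring

theorem singularZeta_sub (κ : ℤ) {μ : Kq} (hμ : μ ≠ 0) (i j : ℤ) :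
    singularZeta κ μ i - singularZeta κ μ j = qint (j - i) * qplus μ (κ - i - j) := by
  have hq := q_ne_zero
  have h := q_sq_sub_one_ne_zero
  simp only [singularZeta, qint, qplus, neg_sub, zpow_sub₀ hq, zpow_neg]
  field_simp
  ring

theorem singularZeta_injective (κ : ℤ) {μ : Kq} (hμ : μ ≠ 0) (h : IsGood μ) :
    Function.Injective (singularZeta κ μ) := by
  intro i j e
  rw [← sub_eq_zero, singularZeta_sub κ hμ, mul_eq_zero, or_iff_left (qplus_ne_zero hμ h _)] at e
  by_contra hne
  exact qint_ne_zero (sub_ne_zero.mpr (Ne.symm hne)) e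

/-- The coefficient, up to a normalisation depending on the basis, with which `B_1` undoes the
`b`-th lowering step; the raising direction uses `-μ⁻¹` in place of `μ`. -/
def b1Coeff (κ : ℤ) (μ ζ : Kq) (b : ℤ) : Kq :=
  -(qint b * qplus μ (-b) * (ζ - singularZeta κ μ (b - 1)))

theorem b1Coeff_eq_zero_iff {κ : ℤ} {μ ζ : Kq} {b : ℤ} (h : qplus μ (-b) ≠ 0) :
    b1Coeff κ μ ζ b = 0 ↔ b = 0 ∨ ζ = singularZeta κ μ (b - 1) := by
  have hb : qint b = 0 ↔ b = 0 :=
    ⟨fun hb => by_contra fun hne => qint_ne_zero hne hb, fun hb => by rw [hb, qint_zero]⟩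
  rw [b1Coeff, neg_eq_zero, mul_eq_zero, mul_eq_zero, or_iff_left h, hb,
    sub_eq_zero]

/-- The identity behind `[B_1, B_{-1}] = [κ - 2(a + b)]` on a weight space. -/
theorem b1Coeff_identity (κ : ℤ) {μ : Kq} (hμ : μ ≠ 0) (ζ : Kq) (a b : ℤ) :
    (b1Coeff κ (-μ⁻¹) ζ (a + 1) - b1Coeff κ μ ζ b) * qplus μ (a - b - 1)
      + (b1Coeff κ μ ζ (b + 1) - b1Coeff κ (-μ⁻¹) ζ a) * qplus μ (a - b + 1)
      = qint (κ - 2 * (a + b)) * qplus μ (a - b) * qplus μ (a - b + 1) * qplus μ (a - b - 1) := by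
  have hq := q_ne_zero
  have h := q_sq_sub_one_ne_zero
  simp only [b1Coeff, singularZeta, qint, qplus, inv_neg (R := Kq), inv_inv, two_mul, neg_add,
    neg_sub, neg_neg, zpow_add₀ hq, zpow_sub₀ hq, zpow_neg, zpow_one]
  field_simp
  ring

section Serre

variable {E : Type*} [AddCommGroup E] [Module Kq E] {μ : Kq} {T U L : Module.End Kq E}

theorem serre_linear_apply (hμ : μ ≠ 0) {n : ℤ} {w : E} (hw : T w = qbr μ n • w)
    (hU : T (U w) = qbr μ (n + 1) • U w) (hL : T (L w) = qbr μ (n - 1) • L w) :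
    (T * T * (U + L) - qint 2 • (T * (U + L) * T) + (U + L) * T * T) w = (U + L) w := by
  have hadd := qbr_add_one_add μ n
  have hmul := qbr_add_one_mul_sub_one hμ n
  simp only [LinearMap.add_apply, LinearMap.sub_apply, LinearMap.smul_apply, Module.End.mul_apply,
    map_add, map_smul, hw, hU, hL]
  match_scalars
  · linear_combination qbr μ (n + 1) * hadd - hmul
  · linear_combination qbr μ (n - 1) * hadd - hmul

theorem serre_quadratic_apply {n : ℤ} {w : E} (hw : T w = qbr μ n • w)
    (hU : T (U w) = qbr μ (n + 1) • U w) (hL : T (L w) = qbr μ (n - 1) • L w)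
    (hUU : T (U (U w)) = qbr μ (n + 1 + 1) • U (U w)) (hLU : T (L (U w)) = qbr μ n • L (U w))
    (hUL : T (U (L w)) = qbr μ n • U (L w)) (hLL : T (L (L w)) = qbr μ (n - 1 - 1) • L (L w))
    (hcomm : qplus μ (n + 1) • L (U w) = qplus μ (n - 1) • U (L w)) :
    ((U + L) * (U + L) * T - qint 2 • ((U + L) * T * (U + L)) + T * (U + L) * (U + L)) w = 0 := by
  have hp := qbr_add_one_add μ (n + 1)
  have hm := qbr_add_one_add μ (n - 1)
  have hp' := qbr_add_one_sub μ (n + 1)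
  have hm' := qbr_add_one_sub μ (n - 1)
  rw [add_sub_cancel_right] at hp hp'
  rw [sub_add_cancel] at hm hm'
  simp only [LinearMap.add_apply, LinearMap.sub_apply, LinearMap.smul_apply, Module.End.mul_apply,
    map_add, map_smul, hw, hU, hL, hUU, hLU, hUL, hLL]
  have hcross : (2 * qbr μ n - qint 2 * qbr μ (n + 1)) • L (U w)
      + (2 * qbr μ n - qint 2 * qbr μ (n - 1)) • U (L w) = 0 := by
    rw [show 2 * qbr μ n - qint 2 * qbr μ (n + 1) = -qplus μ (n + 1) by
        linear_combination hp - hp',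
      show 2 * qbr μ n - qint 2 * qbr μ (n - 1) = qplus μ (n - 1) by
        linear_combination hm + hm', neg_smul, hcomm, neg_add_cancel]
  rw [← hcross]
  match_scalars
  · linear_combination hp
  · ring
  · ring
  · linear_combination hm

end Serre

/-- The parameters of a good Verma module `M(κ_◇, κ_1, [μ; 0], ζ)`. -/
structure GoodWeight where
  κd : ℤ
  κ1 : ℤ
  μ : Kq
  ζ : Kq
  μ_ne_zero : μ ≠ 0
  isGood : IsGood μ

namespace GoodWeight

variable (P : GoodWeight)

/-- The weight `κ = κ_◇ - κ_1` of `D̂_◇ D̂_1⁻¹`. -/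
def κ : ℤ := P.κd - P.κ1

theorem qplus_ne_zero (n : ℤ) : qplus P.μ n ≠ 0 := QSP.qplus_ne_zero P.μ_ne_zero P.isGood n

/-- The coefficient of `W (a - 1) b` in `B_1 W a b`. -/
def cPlus (a b : ℤ) : Kq := b1Coeff P.κ (-P.μ⁻¹) P.ζ a / qplus P.μ (a - b)

/-- The coefficient of `W a (b - 1)` in `B_1 W a b`. -/
def cMinus (a b : ℤ) : Kq := b1Coeff P.κ P.μ P.ζ b / qplus P.μ (a - b)

/-- The space with basis `W a b`, `a b : ℤ`, carrying a representation of `U_q'` in which the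
descendants of `W 0 0` span a copy of the Verma module. -/
def Lattice (_ : GoodWeight) : Type := (ℤ × ℤ) →₀ Kq

instance : AddCommGroup P.Lattice := inferInstanceAs (AddCommGroup ((ℤ × ℤ) →₀ Kq))

instance : Module Kq P.Lattice := inferInstanceAs (Module Kq ((ℤ × ℤ) →₀ Kq))

/-- The basis of the lattice representation. -/
def latticeBasis : Module.Basis (ℤ × ℤ) Kq P.Lattice := .ofRepr (.refl Kq _)

/-- The basis vector `W a b`, of `B_0`-weight `[μ; a - b]`. -/
def W (a b : ℤ) : P.Lattice := P.latticeBasis (a, b)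

/-- The operator `W a b ↦ c a b • W (a + s) (b + t)`. -/
def shift (s t : ℤ) (c : ℤ → ℤ → Kq) : Module.End Kq P.Lattice :=
  P.latticeBasis.constr Kq fun p => c p.1 p.2 • P.W (p.1 + s) (p.2 + t)

@[simp]
theorem shift_W (s t : ℤ) (c : ℤ → ℤ → Kq) (a b : ℤ) :
    P.shift s t c (P.W a b) = c a b • P.W (a + s) (b + t) :=
  P.latticeBasis.constr_basis Kq _ (a, b)

theorem lattice_hom_ext {f g : Module.End Kq P.Lattice} (h : ∀ a b, f (P.W a b) = g (P.W a b)) :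
    f = g :=
  P.latticeBasis.ext fun p => h p.1 p.2

/-- The operators by which the generators of `U_q'` act on the lattice representation. -/
def op : Gen → Module.End Kq P.Lattice
  | .b0 => P.shift 0 0 fun a b => qbr P.μ (a - b)
  | .b1 => P.shift 0 (-1) P.cMinus + P.shift (-1) 0 P.cPlus
  | .bm1 => P.shift 1 0 (fun a b => (qplus P.μ (a - b))⁻¹)
      + P.shift 0 1 (fun a b => (qplus P.μ (a - b))⁻¹)
  | .dd => P.shift 0 0 fun a b => q ^ (P.κd - a - b)
  | .ddInv => P.shift 0 0 fun a b => q ^ (-(P.κd - a - b))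
  | .d1 => P.shift 0 0 fun a b => q ^ (P.κ1 + a + b)
  | .d1Inv => P.shift 0 0 fun a b => q ^ (-(P.κ1 + a + b))

theorem op_b0_W (a b : ℤ) : P.op .b0 (P.W a b) = qbr P.μ (a - b) • P.W a b := by simp [op]

theorem op_b1_W (a b : ℤ) :
    P.op .b1 (P.W a b) = P.cMinus a b • P.W a (b - 1) + P.cPlus a b • P.W (a - 1) b := by
  simp [op, sub_eq_add_neg]

theorem op_bm1_W (a b : ℤ) :
    P.op .bm1 (P.W a b) = (qplus P.μ (a - b))⁻¹ • (P.W (a + 1) b + P.W a (b + 1)) := by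
  simp [op]

theorem op_dd_W (a b : ℤ) : P.op .dd (P.W a b) = q ^ (P.κd - a - b) • P.W a b := by simp [op]

theorem op_ddInv_W (a b : ℤ) : P.op .ddInv (P.W a b) = q ^ (-(P.κd - a - b)) • P.W a b := by
  simp [op]

theorem op_d1_W (a b : ℤ) : P.op .d1 (P.W a b) = q ^ (P.κ1 + a + b) • P.W a b := by simp [op]

theorem op_d1Inv_W (a b : ℤ) : P.op .d1Inv (P.W a b) = q ^ (-(P.κ1 + a + b)) • P.W a b := by
  simp [op]

theorem op_cartan_W (a b : ℤ) :
    ((q - q⁻¹)⁻¹ • (P.op .dd * P.op .d1Inv - P.op .d1 * P.op .ddInv)) (P.W a b) =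
      qint (P.κ - 2 * (a + b)) • P.W a b := by
  simp only [LinearMap.smul_apply, LinearMap.sub_apply, Module.End.mul_apply, op_dd_W, op_d1_W,
    op_ddInv_W, op_d1Inv_W, map_smul, smul_smul, ← sub_smul, ← zpow_add₀ q_ne_zero]
  rw [qint, div_eq_inv_mul, κ]
  ring_nf

theorem op_b1_bm1 :
    P.op .b1 * P.op .bm1 - P.op .bm1 * P.op .b1 =
      (q - q⁻¹)⁻¹ • (P.op .dd * P.op .d1Inv - P.op .d1 * P.op .ddInv) := by
  refine P.lattice_hom_ext fun a b => ?_
  have h := P.qplus_ne_zero (a - b)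
  have hp := P.qplus_ne_zero (a - b + 1)
  have hm := P.qplus_ne_zero (a - b - 1)
  have hid := b1Coeff_identity P.κ P.μ_ne_zero P.ζ a b
  have e1 : a + 1 - b = a - b + 1 := by ring
  have e2 : a - (b + 1) = a - b - 1 := by ring
  have e3 : a - 1 - b = a - b - 1 := by ring
  have e4 : a - (b - 1) = a - b + 1 := by ring
  rw [op_cartan_W, LinearMap.sub_apply, Module.End.mul_apply, Module.End.mul_apply, op_bm1_W,
    op_b1_W]
  simp only [map_smul, map_add, op_b1_W, op_bm1_W, cPlus, cMinus, e1, e2, e3, e4,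
    add_sub_cancel_right, sub_add_cancel]
  generalize -P.μ⁻¹ = ν at hid ⊢
  match_scalars
  · ring
  · field_simp
    linear_combination hid
  · ring

section Shift

variable {s t s' t' : ℤ} {f g : ℤ → ℤ → Kq}

theorem op_b0_shift_W (s t : ℤ) (f : ℤ → ℤ → Kq) (a b : ℤ) :
    P.op .b0 (P.shift s t f (P.W a b)) =
      qbr P.μ (a - b + (s - t)) • P.shift s t f (P.W a b) := by
  rw [shift_W, map_smul, op_b0_W, smul_comm]
  congr 3
  ring

theorem op_b0_shift_shift_W (s t s' t' : ℤ) (f g : ℤ → ℤ → Kq) (a b : ℤ) :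
    P.op .b0 (P.shift s' t' g (P.shift s t f (P.W a b))) =
      qbr P.μ (a - b + (s - t) + (s' - t')) • P.shift s' t' g (P.shift s t f (P.W a b)) := by
  rw [shift_W, map_smul, map_smul, op_b0_shift_W, smul_comm]
  congr 3
  ring

theorem op_serre_linear (hst : s - t = 1) (hst' : s' - t' = -1) {A : Module.End Kq P.Lattice}
    (hA : A = P.shift s t f + P.shift s' t' g) :
    P.op .b0 * P.op .b0 * A - qint 2 • (P.op .b0 * A * P.op .b0) + A * P.op .b0 * P.op .b0 = A := by
  subst hA
  refine P.lattice_hom_ext fun a b => serre_linear_apply P.μ_ne_zero (P.op_b0_W a b) ?_ ?_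
  · rw [op_b0_shift_W, hst]
  · rw [op_b0_shift_W, hst', ← sub_eq_add_neg]

theorem op_serre_quadratic (hst : s - t = 1) (hst' : s' - t' = -1) {A : Module.End Kq P.Lattice}
    (hA : A = P.shift s t f + P.shift s' t' g)
    (hcomm : ∀ a b,
      qplus P.μ (a - b + 1) • P.shift s' t' g (P.shift s t f (P.W a b)) =
        qplus P.μ (a - b - 1) • P.shift s t f (P.shift s' t' g (P.W a b))) :
    A * A * P.op .b0 - qint 2 • (A * P.op .b0 * A) + P.op .b0 * A * A = 0 := by
  subst hA
  refine P.lattice_hom_ext fun a b =>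
    serre_quadratic_apply (P.op_b0_W a b) ?_ ?_ ?_ ?_ ?_ ?_ (hcomm a b)
  all_goals simp only [op_b0_shift_W, op_b0_shift_shift_W, hst, hst', ← sub_eq_add_neg,
    add_sub_cancel_right, sub_add_cancel]

end Shift

theorem op_serre_b1_b0 :
    P.op .b1 * P.op .b1 * P.op .b0 - qint 2 • (P.op .b1 * P.op .b0 * P.op .b1)
      + P.op .b0 * P.op .b1 * P.op .b1 = 0 := by
  refine P.op_serre_quadratic (by norm_num) (by norm_num) rfl fun a b => ?_
  have hp := P.qplus_ne_zero (a - b + 1)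
  have hm := P.qplus_ne_zero (a - b - 1)
  simp only [shift_W, map_smul, smul_smul, cPlus, cMinus, add_zero, ← sub_eq_add_neg]
  rw [show a - (b - 1) = a - b + 1 by ring, show a - 1 - b = a - b - 1 by ring]
  congr 1
  field_simp

theorem op_serre_bm1_b0 :
    P.op .bm1 * P.op .bm1 * P.op .b0 - qint 2 • (P.op .bm1 * P.op .b0 * P.op .bm1)
      + P.op .b0 * P.op .bm1 * P.op .bm1 = 0 := by
  refine P.op_serre_quadratic (by norm_num) (by norm_num) rfl fun a b => ?_
  have hp := P.qplus_ne_zero (a - b + 1)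
  have hm := P.qplus_ne_zero (a - b - 1)
  simp only [shift_W, map_smul, smul_smul, add_zero]
  rw [show a + 1 - b = a - b + 1 by ring, show a - (b + 1) = a - b - 1 by ring]
  congr 1
  field_simp

theorem freeLift_rel {x y : Free} (h : Rel x y) :
    FreeAlgebra.lift Kq P.op x = FreeAlgebra.lift Kq P.op y := by
  have hq := q_ne_zero
  cases h <;> simp only [map_mul, map_add, map_sub, map_smul, map_one, map_zero,
    FreeAlgebra.lift_ι_apply]
  case b1_bm1 => exact P.op_b1_bm1
  case serre_b0_b1 => exact P.op_serre_linear (by norm_num) (by norm_num) rfl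
  case serre_b0_bm1 => exact P.op_serre_linear (by norm_num) (by norm_num) rfl
  case serre_b1_b0 => exact P.op_serre_b1_b0
  case serre_bm1_b0 => exact P.op_serre_bm1_b0
  all_goals
    refine P.lattice_hom_ext fun a b => ?_
    simp only [LinearMap.smul_apply, Module.End.mul_apply, Module.End.one_apply, op_b1_W, op_bm1_W,
      op_dd_W, op_d1_W, op_ddInv_W, op_d1Inv_W, op_b0_W, map_smul, map_add, smul_add, smul_smul,
      zpow_add₀ hq, zpow_sub₀ hq, zpow_neg, zpow_one]
    match_scalars <;> field_simp

/-- The representation of `U_q'` on the lattice. -/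
def rep : Uq' →ₐ[Kq] Module.End Kq P.Lattice :=
  RingQuot.liftAlgHom Kq ⟨FreeAlgebra.lift Kq P.op, fun _ _ h => P.freeLift_rel h⟩

theorem rep_u (g : Gen) : P.rep (u g) = P.op g := by
  rw [rep, u, RingQuot.liftAlgHom_mkAlgHom_apply, gen, FreeAlgebra.lift_ι_apply]

instance : Module Uq' P.Lattice := Module.compHom P.Lattice P.rep.toRingHom

instance : IsScalarTower Kq Uq' P.Lattice where
  smul_assoc c a x := LinearMap.congr_fun (map_smul P.rep c a) x

theorem u_smul (g : Gen) (x : P.Lattice) : u g • x = P.op g x :=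
  LinearMap.congr_fun (P.rep_u g) x

end GoodWeight

theorem mkAlgHom_eq {a b : Free} (h : Rel a b) :
    RingQuot.mkAlgHom Kq Rel a = RingQuot.mkAlgHom Kq Rel b :=
  RingQuot.mkAlgHom_rel Kq h

section Relations

theorem ddInv_mul_Dd : u .ddInv * Dd = 1 := by
  have h := mkAlgHom_eq .inv_dd
  rwa [map_mul, map_one] at h

theorem d1Inv_mul_D1 : u .d1Inv * D1 = 1 := by
  have h := mkAlgHom_eq .inv_d1
  rwa [map_mul, map_one] at h

theorem Dd_mul_Bm1 : Dd * Bm1 = q⁻¹ • (Bm1 * Dd) := by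
  have h := mkAlgHom_eq .dd_bm1
  rwa [map_mul, map_smul, map_mul] at h

theorem D1_mul_Bm1 : D1 * Bm1 = q • (Bm1 * D1) := by
  have h := mkAlgHom_eq .d1_bm1
  rwa [map_mul, map_smul, map_mul] at h

theorem Dd_mul_B0 : Dd * B0 = B0 * Dd := by
  have h := mkAlgHom_eq .dd_b0
  rwa [map_mul, map_mul] at h

theorem D1_mul_B0 : D1 * B0 = B0 * D1 := by
  have h := mkAlgHom_eq .d1_b0
  rwa [map_mul, map_mul] at h

theorem B1_mul_Bm1_sub :
    B1 * Bm1 - Bm1 * B1 = (q - q⁻¹)⁻¹ • (Dd * u .d1Inv - D1 * u .ddInv) := by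
  have h := mkAlgHom_eq .b1_bm1
  simp only [map_mul, map_smul, map_sub] at h
  exact h

theorem serre_B0_B1 : B0 * B0 * B1 - qint 2 • (B0 * B1 * B0) + B1 * B0 * B0 = B1 := by
  have h := mkAlgHom_eq .serre_b0_b1
  simp only [map_mul, map_smul, map_sub, map_add] at h
  exact h

theorem serre_B0_Bm1 : B0 * B0 * Bm1 - qint 2 • (B0 * Bm1 * B0) + Bm1 * B0 * B0 = Bm1 := by
  have h := mkAlgHom_eq .serre_b0_bm1
  simp only [map_mul, map_smul, map_sub, map_add] at h
  exact h

theorem serre_Bm1_B0 : Bm1 * Bm1 * B0 - qint 2 • (Bm1 * B0 * Bm1) + B0 * Bm1 * Bm1 = 0 := by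
  have h := mkAlgHom_eq .serre_bm1_b0
  simp only [map_mul, map_smul, map_sub, map_add, map_zero] at h
  exact h

end Relations

section WeightVector

variable {V : Type*} [AddCommGroup V] [Module Kq V] [Module Uq' V]

/-- Simultaneous eigenvectors of `D̂_◇`, `D̂_1` and `B_0`, with eigenvalues `q^d`, `q^e`, `β`. -/
structure IsWeightVector (d e : ℤ) (β : Kq) (x : V) : Prop where
  dd : Dd • x = q ^ d • x
  d1 : D1 • x = q ^ e • x
  b0 : B0 • x = β • x

/-- The component of `B_{-1} x`, up to the factor `qplus μ n`, of `B_0`-weight `[μ; n + 1]`, for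
`x` of `B_0`-weight `[μ; n]`. -/
def raise (μ : Kq) (n : ℤ) (x : V) : V := B0 • Bm1 • x - qbr μ (n - 1) • Bm1 • x

/-- The component of `B_{-1} x`, up to the factor `qplus μ n`, of `B_0`-weight `[μ; n - 1]`, for
`x` of `B_0`-weight `[μ; n]`. -/
def lower (μ : Kq) (n : ℤ) (x : V) : V := qbr μ (n + 1) • Bm1 • x - B0 • Bm1 • x

theorem raise_add_lower (μ : Kq) (n : ℤ) (x : V) :
    raise μ n x + lower μ n x = qplus μ n • Bm1 • x := by
  rw [raise, lower, ← qbr_add_one_sub, sub_smul]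
  abel

variable [IsScalarTower Kq Uq' V]

theorem inv_smul_eq {a b : Uq'} (hab : a * b = 1) {n : ℤ} {x : V} (hx : b • x = q ^ n • x) :
    a • x = q ^ (-n) • x := by
  have h : q ^ n • a • x = x := by rw [smul_comm, ← hx, ← mul_smul, hab, one_smul]
  rw [zpow_neg, eq_inv_smul_iff₀ (zpow_ne_zero n q_ne_zero), h]

theorem IsWeightVector.B1_Bm1_smul {d e : ℤ} {β : Kq} {x : V} (hx : IsWeightVector d e β x) :
    B1 • Bm1 • x = Bm1 • B1 • x + qint (d - e) • x := by
  have hd : (Dd * u .d1Inv) • x = q ^ (d - e) • x := by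
    rw [mul_smul, inv_smul_eq d1Inv_mul_D1 hx.d1, smul_comm Dd, hx.dd, smul_smul,
      ← zpow_add₀ q_ne_zero, neg_add_eq_sub]
  have he : (D1 * u .ddInv) • x = q ^ (-(d - e)) • x := by
    rw [mul_smul, inv_smul_eq ddInv_mul_Dd hx.dd, smul_comm D1, hx.d1, smul_smul,
      ← zpow_add₀ q_ne_zero, neg_add_eq_sub, neg_sub]
  have h := congrArg (· • x) B1_mul_Bm1_sub
  simp only [sub_smul, mul_smul B1, mul_smul Bm1, smul_assoc] at h
  rw [hd, he, ← sub_smul, smul_smul (q - q⁻¹)⁻¹, inv_mul_eq_div] at h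
  rw [← sub_eq_iff_eq_add', h, qint]

theorem B0_B0_smul {A : Uq'}
    (hA : B0 * B0 * A - qint 2 • (B0 * A * B0) + A * B0 * B0 = A) {μ : Kq} (hμ : μ ≠ 0) {n : ℤ}
    {x : V} (hx : B0 • x = qbr μ n • x) :
    B0 • B0 • A • x = (qbr μ (n + 1) + qbr μ (n - 1)) • B0 • A • x
      - (qbr μ (n + 1) * qbr μ (n - 1)) • A • x := by
  have h := congrArg (· • x) hA
  simp only [add_smul, sub_smul, mul_smul, smul_assoc, hx, smul_comm _ (qbr μ n)] at h
  rw [qbr_add_one_add, qbr_add_one_mul_sub_one hμ]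
  generalize A • x = y at *
  generalize B0 • B0 • y = y2 at *
  generalize B0 • y = y1 at *
  linear_combination (norm := module) h

theorem map_raise {V' : Type*} [AddCommGroup V'] [Module Kq V'] [Module Uq' V']
    [IsScalarTower Kq Uq' V'] (φ : V →ₗ[Uq'] V') (μ : Kq) (n : ℤ) (x : V) :
    φ (raise μ n x) = raise μ n (φ x) := by
  simp only [raise, map_sub, φ.map_smul_of_tower]

theorem map_lower {V' : Type*} [AddCommGroup V'] [Module Kq V'] [Module Uq' V']
    [IsScalarTower Kq Uq' V'] (φ : V →ₗ[Uq'] V') (μ : Kq) (n : ℤ) (x : V) :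
    φ (lower μ n x) = lower μ n (φ x) := by
  simp only [lower, map_sub, φ.map_smul_of_tower]

variable {μ : Kq} {d e n : ℤ} {x : V}

theorem IsWeightVector.Dd_Bm1_smul {β : Kq} (hx : IsWeightVector d e β x) :
    Dd • Bm1 • x = q ^ (d - 1) • Bm1 • x := by
  rw [← mul_smul, Dd_mul_Bm1, smul_assoc, mul_smul, hx.dd, smul_comm Bm1, smul_smul,
    zpow_sub_one₀ q_ne_zero, mul_comm]

theorem IsWeightVector.D1_Bm1_smul {β : Kq} (hx : IsWeightVector d e β x) :
    D1 • Bm1 • x = q ^ (e + 1) • Bm1 • x := by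
  rw [← mul_smul, D1_mul_Bm1, smul_assoc, mul_smul, hx.d1, smul_comm Bm1, smul_smul,
    zpow_add_one₀ q_ne_zero, mul_comm]

theorem IsWeightVector.Dd_B0_Bm1_smul {β : Kq} (hx : IsWeightVector d e β x) :
    Dd • B0 • Bm1 • x = q ^ (d - 1) • B0 • Bm1 • x := by
  rw [← mul_smul, Dd_mul_B0, mul_smul, hx.Dd_Bm1_smul, smul_comm B0]

theorem IsWeightVector.D1_B0_Bm1_smul {β : Kq} (hx : IsWeightVector d e β x) :
    D1 • B0 • Bm1 • x = q ^ (e + 1) • B0 • Bm1 • x := by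
  rw [← mul_smul, D1_mul_B0, mul_smul, hx.D1_Bm1_smul, smul_comm B0]

theorem IsWeightVector.raise (hμ : μ ≠ 0) (hx : IsWeightVector d e (qbr μ n) x) :
    IsWeightVector (d - 1) (e + 1) (qbr μ (n + 1)) (raise μ n x) where
  dd := by
    rw [QSP.raise, smul_sub, smul_comm Dd (qbr μ _), hx.Dd_B0_Bm1_smul,
      hx.Dd_Bm1_smul, smul_sub, smul_comm (qbr μ _)]
  d1 := by
    rw [QSP.raise, smul_sub, smul_comm D1 (qbr μ _), hx.D1_B0_Bm1_smul,
      hx.D1_Bm1_smul, smul_sub, smul_comm (qbr μ _)]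
  b0 := by
    rw [QSP.raise, smul_sub, smul_comm B0 (qbr μ _), B0_B0_smul serre_B0_Bm1 hμ hx.b0]
    generalize B0 • Bm1 • x = y
    generalize Bm1 • x = z
    module

theorem IsWeightVector.lower (hμ : μ ≠ 0) (hx : IsWeightVector d e (qbr μ n) x) :
    IsWeightVector (d - 1) (e + 1) (qbr μ (n - 1)) (lower μ n x) where
  dd := by
    rw [QSP.lower, smul_sub, smul_comm Dd (qbr μ _), hx.Dd_B0_Bm1_smul,
      hx.Dd_Bm1_smul, smul_sub, smul_comm (qbr μ _)]
  d1 := by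
    rw [QSP.lower, smul_sub, smul_comm D1 (qbr μ _), hx.D1_B0_Bm1_smul,
      hx.D1_Bm1_smul, smul_sub, smul_comm (qbr μ _)]
  b0 := by
    rw [QSP.lower, smul_sub, smul_comm B0 (qbr μ _), B0_B0_smul serre_B0_Bm1 hμ hx.b0]
    generalize B0 • Bm1 • x = y
    generalize Bm1 • x = z
    module

theorem lower_raise (hx : B0 • x = qbr μ n • x) :
    lower μ (n + 1) (raise μ n x) = raise μ (n - 1) (lower μ n x) := by
  have h := congrArg (qplus μ n • · • x) serre_Bm1_B0
  have hp := qbr_add_one_add μ (n + 1)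
  have hm := qbr_add_one_add μ (n - 1)
  have hn := qbr_add_one_sub μ n
  rw [add_sub_cancel_right] at hp
  rw [sub_add_cancel] at hm
  simp only [add_smul, sub_smul, mul_smul, smul_assoc, hx, smul_comm _ (qbr μ n), zero_smul,
    smul_zero] at h
  simp only [raise, lower, smul_sub, smul_comm Bm1, smul_comm B0]
  generalize Bm1 • Bm1 • x = y at *
  generalize B0 • Bm1 • B0 • Bm1 • x = y1 at *
  generalize Bm1 • B0 • Bm1 • x = y2 at *
  generalize B0 • y = y3 at *
  rw [← sub_eq_zero, ← neg_eq_zero, ← h]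
  match_scalars
  · linear_combination hm - hp - qint 2 * hn
  · linear_combination qbr μ n * hn + qbr μ (n - 1) * hp - qbr μ (n + 1) * hm
  · ring
  · linear_combination hn

end WeightVector

section Descendant

variable {V : Type*} [AddCommGroup V] [Module Kq V] [Module Uq' V]

/-- The vector obtained from `v`, of `B_0`-weight `[μ; 0]`, by `b` lowering and then `a` raising
steps; it has `B_0`-weight `[μ; a - b]`. -/
def descendant (μ : Kq) (v : V) : ℕ → ℕ → V
  | 0, 0 => v
  | 0, b + 1 => lower μ (-b) (descendant μ v 0 b)
  | a + 1, b => raise μ (a - b) (descendant μ v a b)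

variable [IsScalarTower Kq Uq' V]

theorem map_descendant {V' : Type*} [AddCommGroup V'] [Module Kq V'] [Module Uq' V']
    [IsScalarTower Kq Uq' V'] (φ : V →ₗ[Uq'] V') (μ : Kq) (v : V) :
    ∀ a b, φ (descendant μ v a b) = descendant μ (φ v) a b
  | 0, 0 => by rw [descendant, descendant]
  | 0, b + 1 => by rw [descendant, map_lower, map_descendant φ μ v 0 b, ← descendant]
  | a + 1, b => by rw [descendant, map_raise, map_descendant φ μ v a b, ← descendant]

variable {μ : Kq} {d e : ℤ} {v : V}

theorem isWeightVector_descendant (hμ : μ ≠ 0) (hv : IsWeightVector d e (qbr μ 0) v) (a b : ℕ) :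
    IsWeightVector (d - a - b) (e + a + b) (qbr μ (a - b)) (descendant μ v a b) := by
  induction a with
  | zero =>
    induction b with
    | zero => simpa [descendant] using hv
    | succ b ih =>
      rw [descendant]
      convert IsWeightVector.lower hμ (n := -b) (by simpa using ih) using 1 <;>
        push_cast <;> ring_nf
  | succ a ih =>
    rw [descendant]
    convert ih.raise hμ using 1 <;> push_cast <;> ring_nf

theorem descendant_add_one_right (hμ : μ ≠ 0) (hv : IsWeightVector d e (qbr μ 0) v) (a b : ℕ) :
    descendant μ v a (b + 1) = lower μ (a - b) (descendant μ v a b) := by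
  induction a with
  | zero => rw [descendant, Nat.cast_zero, zero_sub]
  | succ a ih =>
    rw [descendant, ih, descendant, Nat.cast_add_one, Nat.cast_add_one, add_sub_right_comm,
      lower_raise (isWeightVector_descendant hμ hv a b).b0, sub_sub]

theorem qplus_smul_Bm1_descendant (hμ : μ ≠ 0) (hv : IsWeightVector d e (qbr μ 0) v) (a b : ℕ) :
    qplus μ (a - b) • Bm1 • descendant μ v a b =
      descendant μ v (a + 1) b + descendant μ v a (b + 1) := by
  rw [descendant_add_one_right hμ hv, descendant, raise_add_lower]

end Descendant

section Singular

variable {V : Type*} [AddCommGroup V] [Module Kq V] [Module Uq' V]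

/-- Vectors on which the subalgebra inducing the Verma module `M(d, e, β, ζ)` acts as on the
highest weight vector; that `X` annihilates them is a consequence, see `IsSingular.X_smul`. -/
structure IsSingular (d e : ℤ) (β ζ : Kq) (x : V) : Prop extends IsWeightVector d e β x where
  b1 : B1 • x = 0
  z : Z • x = ζ • x

variable [IsScalarTower Kq Uq' V] {d e : ℤ} {β ζ : Kq} {x : V}

theorem IsSingular.X_smul (hx : IsSingular d e β ζ x) : X • x = 0 := by
  rw [X, qcomm, sub_smul, smul_assoc, mul_smul, mul_smul, hx.b1, hx.b0, smul_comm B1, hx.b1,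
    smul_zero, smul_zero, smul_zero, sub_zero]

theorem Z_smul_of_B1_smul_eq_zero {μ : Kq} {n : ℤ} (hx : IsWeightVector d e (qbr μ n) x)
    (h : B1 • x = 0) :
    Z • x = (q ^ n * μ * qint (d - e)) • x - B1 • lower μ n x := by
  have hB := hx.B1_Bm1_smul
  rw [h, smul_zero, zero_add] at hB
  rw [Z, Y, qcomm, qcomm, sub_smul, smul_assoc, mul_smul, mul_smul _ B1, h, smul_zero, smul_zero,
    sub_zero, sub_smul, smul_assoc, mul_smul, mul_smul, hx.b0, smul_comm Bm1 (qbr μ n), lower,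
    smul_sub, smul_sub, smul_comm B1 (qbr μ _), smul_comm B1 q⁻¹, smul_comm B1 (qbr μ _), hB,
    ← qbr_add_one_sub_qinv_mul]
  generalize B1 • B0 • Bm1 • x = y
  module

end Singular

variable {V : Type*} [AddCommGroup V] [Module Kq V] [Module Uq' V]

/-- The `ℂ(q)`-span of the descendants of `v`. -/
def descendantSpan (μ : Kq) (v : V) : Submodule Kq V :=
  Submodule.span Kq (Set.range fun p : ℕ × ℕ => descendant μ v p.1 p.2)

theorem descendant_mem (μ : Kq) (v : V) (a b : ℕ) : descendant μ v a b ∈ descendantSpan μ v :=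
  Submodule.subset_span ⟨(a, b), rfl⟩

theorem smul_sub_smul_mem_of_add_mem {N : Submodule Kq V} {A : Uq'} (hN : ∀ x ∈ N, A • x ∈ N)
    {c r s : Kq} (hrs : r ≠ s) {x y : V} (hx : A • A • x = (c + r) • A • x - (c * r) • x)
    (hy : A • A • y = (c + s) • A • y - (c * s) • y) (hxy : x + y ∈ N) : A • y - c • y ∈ N := by
  have hmem : A • A • (x + y) - (c + r) • A • (x + y) + (c * r) • (x + y) ∈ N :=
    N.add_mem (N.sub_mem (hN _ (hN _ hxy)) (N.smul_mem _ (hN _ hxy))) (N.smul_mem _ hxy)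
  rw [← N.smul_mem_iff (sub_ne_zero.mpr hrs.symm)]
  convert hmem using 1
  rw [smul_add A x y, smul_add A, hx, hy]
  generalize A • x = x1
  generalize A • y = y1
  module

variable [IsScalarTower Kq Uq' V]

theorem smul_mem_of_generators {N : Submodule Kq V} (hN : ∀ g, ∀ x ∈ N, u g • x ∈ N) (w : Uq')
    {x : V} (hx : x ∈ N) : w • x ∈ N := by
  obtain ⟨w, rfl⟩ := RingQuot.mkAlgHom_surjective Kq Rel w
  induction w using FreeAlgebra.induction generalizing x with
  | grade0 c =>
    rw [AlgHom.commutes, algebraMap_smul]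
    exact N.smul_mem c hx
  | grade1 g => exact hN g x hx
  | mul y z hy hz =>
    rw [map_mul, mul_smul]
    exact hy (hz hx)
  | add y z hy hz =>
    rw [map_add, add_smul]
    exact N.add_mem (hy hx) (hz hx)

variable {μ : Kq} {d e : ℤ} {v x : V} {ζ : Kq}

theorem smul_mem_descendantSpan {A : Uq'}
    (hA : ∀ a b, A • descendant μ v a b ∈ descendantSpan μ v) (hx : x ∈ descendantSpan μ v) :
    A • x ∈ descendantSpan μ v := by
  have hle : descendantSpan μ v ≤ (descendantSpan μ v).comap (Algebra.lsmul Kq Kq V A) :=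
    Submodule.span_le.mpr <| Set.range_subset_iff.mpr fun p => hA p.1 p.2
  exact hle hx

theorem B0_smul_mem_descendantSpan (hμ : μ ≠ 0) (hv : IsWeightVector d e (qbr μ 0) v)
    (hx : x ∈ descendantSpan μ v) : B0 • x ∈ descendantSpan μ v :=
  smul_mem_descendantSpan (fun a b => by
    rw [(isWeightVector_descendant hμ hv a b).b0]
    exact Submodule.smul_mem _ _ (descendant_mem μ v a b)) hx

theorem Bm1_smul_mem_descendantSpan (hμ : μ ≠ 0) (hgood : IsGood μ)
    (hv : IsWeightVector d e (qbr μ 0) v) (hx : x ∈ descendantSpan μ v) :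
    Bm1 • x ∈ descendantSpan μ v :=
  smul_mem_descendantSpan (fun a b => by
    rw [← Submodule.smul_mem_iff _ (qplus_ne_zero hμ hgood (a - b)),
      qplus_smul_Bm1_descendant hμ hv]
    exact Submodule.add_mem _ (descendant_mem μ v _ _) (descendant_mem μ v _ _)) hx

theorem B1_smul_add_mem (hμ : μ ≠ 0) (hgood : IsGood μ) (hv : IsWeightVector d e (qbr μ 0) v)
    {a b : ℕ} (h : B1 • descendant μ v a b ∈ descendantSpan μ v) :
    B1 • descendant μ v (a + 1) b + B1 • descendant μ v a (b + 1) ∈ descendantSpan μ v := by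
  rw [← smul_add, ← qplus_smul_Bm1_descendant hμ hv, smul_comm B1,
    (isWeightVector_descendant hμ hv a b).B1_Bm1_smul]
  exact Submodule.smul_mem _ _ (Submodule.add_mem _ (Bm1_smul_mem_descendantSpan hμ hgood hv h)
    (Submodule.smul_mem _ _ (descendant_mem μ v a b)))

/-- Modulo `N`, `B_1 y` is annihilated by the quadratic polynomials in `B_0` that annihilate
`B_1 x`, `B_1 y` and `B_1 z`, and these have no common root. -/
theorem B1_smul_mem_of_neighbours (hμ : μ ≠ 0) (hgood : IsGood μ) {N : Submodule Kq V}
    (hN : ∀ x ∈ N, B0 • x ∈ N) {n : ℤ} {x y z : V} (hx : B0 • x = qbr μ (n + 1 + 1) • x)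
    (hy : B0 • y = qbr μ n • y) (hz : B0 • z = qbr μ (n - 1 - 1) • z)
    (hxy : B1 • x + B1 • y ∈ N) (hyz : B1 • y + B1 • z ∈ N) : B1 • y ∈ N := by
  have hne {m k : ℤ} (h : m ≠ k) : qbr μ m ≠ qbr μ k := (qbr_injective hμ hgood).ne h
  have hx2 := B0_B0_smul serre_B0_B1 hμ hx
  have hy2 := B0_B0_smul serre_B0_B1 hμ hy
  have hz2 := B0_B0_smul serre_B0_B1 hμ hz
  rw [add_sub_cancel_right, add_comm (qbr μ _), mul_comm (qbr μ _)] at hx2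
  rw [sub_add_cancel] at hz2
  have hplus := smul_sub_smul_mem_of_add_mem hN (hne (by omega)) hx2 hy2 hxy
  rw [add_comm (qbr μ _), mul_comm (qbr μ _)] at hy2
  rw [add_comm] at hyz
  have hminus := smul_sub_smul_mem_of_add_mem hN (hne (by omega)) hz2 hy2 hyz
  have h := N.sub_mem hminus hplus
  rwa [sub_sub_sub_cancel_left, ← sub_smul, N.smul_mem_iff (sub_ne_zero.mpr (hne (by omega)))] at h

theorem B1_smul_descendant_zero_one_mem (hv : IsSingular d e (qbr μ 0) ζ v) :
    B1 • descendant μ v 0 1 ∈ descendantSpan μ v := by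
  have hmem := descendant_mem μ v 0 0
  have h := Z_smul_of_B1_smul_eq_zero hv.toIsWeightVector hv.b1
  rw [hv.z, eq_sub_iff_add_eq, ← eq_sub_iff_add_eq', ← sub_smul] at h
  rw [descendant, descendant, Nat.cast_zero, neg_zero, h]
  rw [descendant] at hmem
  exact Submodule.smul_mem _ _ hmem

theorem B1_smul_descendant_mem (hμ : μ ≠ 0) (hgood : IsGood μ) (hv : IsSingular d e (qbr μ 0) ζ v)
    {N a b : ℕ} (hN : a + b = N) : B1 • descendant μ v a b ∈ descendantSpan μ v := by
  have hw := hv.toIsWeightVector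
  have hadd {a b : ℕ} := B1_smul_add_mem hμ hgood hw (a := a) (b := b)
  induction N generalizing a b with
  | zero =>
    obtain ⟨rfl, rfl⟩ := Nat.add_eq_zero_iff.mp hN
    rw [descendant, hv.b1]
    exact Submodule.zero_mem _
  | succ N ih =>
    have interior {a b : ℕ} (hab : a + b + 1 = N) :
        B1 • descendant μ v (a + 1) (b + 1) ∈ descendantSpan μ v :=
      B1_smul_mem_of_neighbours hμ hgood (fun _ => B0_smul_mem_descendantSpan hμ hw)
        (by convert (isWeightVector_descendant hμ hw (a + 2) b).b0 using 3; push_cast; ring)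
        (isWeightVector_descendant hμ hw (a + 1) (b + 1)).b0
        (by convert (isWeightVector_descendant hμ hw a (b + 2)).b0 using 3; push_cast; ring)
        (hadd (ih (by omega))) (hadd (ih (by omega)))
    match a, b, N with
    | a + 1, b + 1, _ => exact interior (by omega)
    | 0, 1, _ => exact B1_smul_descendant_zero_one_mem hv
    | 1, 0, 0 =>
      exact ((descendantSpan μ v).add_mem_iff_left (B1_smul_descendant_zero_one_mem hv)).mp
        (hadd (ih rfl))
    | 0, b + 2, N + 1 =>
      exact ((descendantSpan μ v).add_mem_iff_right (interior (by omega))).mp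
        (hadd (ih (by omega)))
    | a + 2, 0, N + 1 =>
      exact ((descendantSpan μ v).add_mem_iff_left (interior (by omega))).mp
        (hadd (ih (by omega)))

theorem smul_mem_descendantSpan_of_isSingular (hμ : μ ≠ 0) (hgood : IsGood μ)
    (hv : IsSingular d e (qbr μ 0) ζ v) (w : Uq') (hx : x ∈ descendantSpan μ v) :
    w • x ∈ descendantSpan μ v := by
  have hw := hv.toIsWeightVector
  have hdesc := isWeightVector_descendant hμ hw
  have eigen {A : Uq'} {a b : ℕ} {c : Kq} (h : A • descendant μ v a b = c • descendant μ v a b) :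
      A • descendant μ v a b ∈ descendantSpan μ v :=
    h ▸ Submodule.smul_mem _ c (descendant_mem μ v a b)
  refine smul_mem_of_generators (fun g x hx => ?_) w hx
  cases g with
  | b0 => exact B0_smul_mem_descendantSpan hμ hw hx
  | b1 => exact smul_mem_descendantSpan (fun a b => B1_smul_descendant_mem hμ hgood hv rfl) hx
  | bm1 => exact Bm1_smul_mem_descendantSpan hμ hgood hw hx
  | dd => exact smul_mem_descendantSpan (fun a b => eigen (hdesc a b).dd) hx
  | d1 => exact smul_mem_descendantSpan (fun a b => eigen (hdesc a b).d1) hx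
  | ddInv =>
    exact smul_mem_descendantSpan
      (fun a b => eigen (inv_smul_eq ddInv_mul_Dd (hdesc a b).dd)) hx
  | d1Inv =>
    exact smul_mem_descendantSpan
      (fun a b => eigen (inv_smul_eq d1Inv_mul_D1 (hdesc a b).d1)) hx

section Universal

variable {V : Type*} [AddCommGroup V] [Module Uq' V] {d e : ℤ} {β ζ : Kq}

/-- The class of `1`, which generates the Verma module. -/
def highestVector (d e : ℤ) (β ζ : Kq) : Verma d e β ζ := Submodule.Quotient.mk 1

theorem smul_highestVector (w : Uq') :
    w • highestVector d e β ζ = (vermaIdeal d e β ζ).mkQ w := by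
  rw [highestVector, ← Submodule.Quotient.mk_smul, smul_eq_mul, mul_one, Submodule.mkQ_apply]

theorem verma_hom_ext {φ ψ : Verma d e β ζ →ₗ[Uq'] V}
    (h : φ (highestVector d e β ζ) = ψ (highestVector d e β ζ)) : φ = ψ :=
  Submodule.linearMap_qext _ (LinearMap.ext_ring h)

theorem map_highestVector_ne_zero {φ : Verma d e β ζ →ₗ[Uq'] V} (hφ : φ ≠ 0) :
    φ (highestVector d e β ζ) ≠ 0 := fun h => hφ (verma_hom_ext h)

theorem highestVector_isSingular (d e : ℤ) (β ζ : Kq) :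
    IsSingular d e β ζ (highestVector d e β ζ) := by
  have hsub : ∀ {A : Uq'} {c : Kq}, A - algebraMap Kq Uq' c ∈ vermaIdeal d e β ζ →
      A • highestVector d e β ζ = c • highestVector d e β ζ := by
    intro A c h
    have h0 : (A - algebraMap Kq Uq' c) • highestVector d e β ζ = 0 := by
      rw [smul_highestVector, Submodule.mkQ_apply, (Submodule.Quotient.mk_eq_zero _).mpr h]
    rwa [sub_smul, sub_eq_zero, algebraMap_smul] at h0
  refine ⟨⟨hsub ?_, hsub ?_, hsub ?_⟩, ?_, hsub ?_⟩
  case refine_4 =>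
    rw [smul_highestVector, Submodule.mkQ_apply, Submodule.Quotient.mk_eq_zero]
    exact Submodule.subset_span (by simp)
  all_goals exact Submodule.subset_span (by simp)

variable [Module Kq V] [IsScalarTower Kq Uq' V]

theorem IsSingular.smul {x : V} (hx : IsSingular d e β ζ x) (c : Kq) :
    IsSingular d e β ζ (c • x) where
  dd := by rw [smul_comm, hx.dd, smul_comm]
  d1 := by rw [smul_comm, hx.d1, smul_comm]
  b0 := by rw [smul_comm, hx.b0, smul_comm]
  b1 := by rw [smul_comm, hx.b1, smul_zero]
  z := by rw [smul_comm, hx.z, smul_comm]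

section Map

variable {V' : Type*} [AddCommGroup V'] [Module Kq V'] [Module Uq' V'] [IsScalarTower Kq Uq' V']

theorem IsSingular.map {x : V} (hx : IsSingular d e β ζ x) (φ : V →ₗ[Uq'] V') :
    IsSingular d e β ζ (φ x) where
  dd := by rw [← map_smul, hx.dd, φ.map_smul_of_tower]
  d1 := by rw [← map_smul, hx.d1, φ.map_smul_of_tower]
  b0 := by rw [← map_smul, hx.b0, φ.map_smul_of_tower]
  b1 := by rw [← map_smul, hx.b1, map_zero]
  z := by rw [← map_smul, hx.z, φ.map_smul_of_tower]

theorem IsSingular.of_map {φ : V →ₗ[Uq'] V'} (hφ : Function.Injective φ) {x : V}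
    (h : IsSingular d e β ζ (φ x)) : IsSingular d e β ζ x where
  dd := hφ (by rw [map_smul, h.dd, φ.map_smul_of_tower])
  d1 := hφ (by rw [map_smul, h.d1, φ.map_smul_of_tower])
  b0 := hφ (by rw [map_smul, h.b0, φ.map_smul_of_tower])
  b1 := hφ (by rw [map_smul, h.b1, map_zero])
  z := hφ (by rw [map_smul, h.z, φ.map_smul_of_tower])

end Map

/-- The homomorphism from a Verma module that sends its highest weight vector to a given singular
vector. -/
def vermaLift {x : V} (hx : IsSingular d e β ζ x) : Verma d e β ζ →ₗ[Uq'] V :=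
  (vermaIdeal d e β ζ).liftQ (LinearMap.toSpanSingleton Uq' V x) <| by
    refine Submodule.span_le.mpr ?_
    simp [Set.insert_subset_iff, sub_smul, hx.b1, hx.X_smul, hx.dd, hx.d1, hx.b0, hx.z]

theorem vermaLift_highestVector {x : V} (hx : IsSingular d e β ζ x) :
    vermaLift hx (highestVector d e β ζ) = x := by
  exact (Submodule.liftQ_apply _ _ _).trans (one_smul Uq' x)

end Universal

theorem descendantSpan_highestVector {μ : Kq} (hμ : μ ≠ 0) (hgood : IsGood μ) (d e : ℤ) (ζ : Kq) :
    descendantSpan μ (highestVector d e (qbr μ 0) ζ) = ⊤ := by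
  refine Submodule.eq_top_iff'.mpr fun x => ?_
  obtain ⟨w, rfl⟩ := Submodule.mkQ_surjective _ x
  rw [← smul_highestVector]
  refine smul_mem_descendantSpan_of_isSingular hμ hgood (highestVector_isSingular ..) w ?_
  have h := descendant_mem μ (highestVector d e (qbr μ 0) ζ) 0 0
  rwa [descendant] at h

namespace GoodWeight

variable (P : GoodWeight)

theorem isWeightVector_W (a b : ℤ) :
    IsWeightVector (P.κd - a - b) (P.κ1 + a + b) (qbr P.μ (a - b)) (P.W a b) where
  dd := (P.u_smul _ _).trans (P.op_dd_W a b)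
  d1 := (P.u_smul _ _).trans (P.op_d1_W a b)
  b0 := (P.u_smul _ _).trans (P.op_b0_W a b)

theorem B1_smul_W (a b : ℤ) :
    B1 • P.W a b = P.cMinus a b • P.W a (b - 1) + P.cPlus a b • P.W (a - 1) b :=
  (P.u_smul _ _).trans (P.op_b1_W a b)

theorem Bm1_smul_W (a b : ℤ) :
    Bm1 • P.W a b = (qplus P.μ (a - b))⁻¹ • (P.W (a + 1) b + P.W a (b + 1)) :=
  (P.u_smul _ _).trans (P.op_bm1_W a b)

theorem B0_Bm1_smul_W (a b : ℤ) :
    B0 • Bm1 • P.W a b = (qplus P.μ (a - b))⁻¹ •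
      (qbr P.μ (a - b + 1) • P.W (a + 1) b + qbr P.μ (a - b - 1) • P.W a (b + 1)) := by
  rw [Bm1_smul_W, smul_comm B0, smul_add, (P.isWeightVector_W _ _).b0,
    (P.isWeightVector_W _ _).b0, add_sub_right_comm, sub_add_eq_sub_sub]

theorem raise_W (a b : ℤ) : raise P.μ (a - b) (P.W a b) = P.W (a + 1) b := by
  have h := P.qplus_ne_zero (a - b)
  rw [raise, B0_Bm1_smul_W, Bm1_smul_W, smul_comm (qbr P.μ _), ← smul_sub, inv_smul_eq_iff₀ h,
    ← qbr_add_one_sub]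
  module

theorem lower_W (a b : ℤ) : lower P.μ (a - b) (P.W a b) = P.W a (b + 1) := by
  have h := P.qplus_ne_zero (a - b)
  rw [lower, B0_Bm1_smul_W, Bm1_smul_W, smul_comm (qbr P.μ _), ← smul_sub, inv_smul_eq_iff₀ h,
    ← qbr_add_one_sub]
  module

theorem descendant_W : ∀ a b : ℕ, descendant P.μ (P.W 0 0) a b = P.W a b
  | 0, 0 => by rw [descendant, Nat.cast_zero]
  | 0, b + 1 => by
    rw [descendant, descendant_W 0 b, Nat.cast_zero, ← zero_sub, lower_W, Nat.cast_add_one]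
  | a + 1, b => by rw [descendant, descendant_W a b, raise_W, Nat.cast_add_one]

theorem cPlus_eq_zero_iff {a b : ℤ} :
    P.cPlus a b = 0 ↔ a = 0 ∨ P.ζ = singularZeta P.κ P.μ (P.κ - (a - 1)) := by
  have h : qplus (-P.μ⁻¹) (-a) ≠ 0 := by
    rw [qplus_neg_inv]
    exact neg_ne_zero.mpr (P.qplus_ne_zero _)
  rw [cPlus, div_eq_zero_iff, or_iff_left (P.qplus_ne_zero _), b1Coeff_eq_zero_iff h,
    singularZeta_neg_inv]

theorem cMinus_eq_zero_iff {a b : ℤ} :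
    P.cMinus a b = 0 ↔ b = 0 ∨ P.ζ = singularZeta P.κ P.μ (b - 1) := by
  rw [cMinus, div_eq_zero_iff, or_iff_left (P.qplus_ne_zero _),
    b1Coeff_eq_zero_iff (P.qplus_ne_zero _)]

/-- The eigenvalue of `Z` on `W a b`, when `B_1` annihilates `W a b`. -/
def zEigenvalue (a b : ℤ) : Kq :=
  q ^ (a - b) * P.μ * qint (P.κ - 2 * (a + b)) - P.cMinus a (b + 1)

theorem Z_smul_W {a b : ℤ} (hplus : P.cPlus a b = 0) (hminus : P.cMinus a b = 0) :
    Z • P.W a b = P.zEigenvalue a b • P.W a b := by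
  have hB1 : B1 • P.W a b = 0 := by
    rw [B1_smul_W, hplus, hminus, zero_smul, zero_smul, add_zero]
  have hplus' : P.cPlus a (b + 1) = 0 := P.cPlus_eq_zero_iff.mpr (P.cPlus_eq_zero_iff.mp hplus)
  rw [Z_smul_of_B1_smul_eq_zero (P.isWeightVector_W a b) hB1, lower_W, B1_smul_W, hplus',
    zero_smul, add_zero, add_sub_cancel_right, ← sub_smul, zEigenvalue, κ]
  ring_nf

theorem W_ne_zero (a b : ℤ) : P.W a b ≠ 0 := P.latticeBasis.ne_zero (a, b)

theorem B1_smul_W_eq_zero_iff {a b : ℤ} :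
    B1 • P.W a b = 0 ↔ P.cPlus a b = 0 ∧ P.cMinus a b = 0 := by
  refine ⟨fun h => ?_, fun ⟨hplus, hminus⟩ => ?_⟩
  · have hrepr := congrArg P.latticeBasis.repr ((P.B1_smul_W a b).symm.trans h)
    exact ⟨by simpa [W, Finsupp.single_apply] using DFunLike.congr_fun hrepr (a - 1, b),
      by simpa [W, Finsupp.single_apply] using DFunLike.congr_fun hrepr (a, b - 1)⟩
  · rw [B1_smul_W, hplus, hminus, zero_smul, zero_smul, add_zero]

theorem isSingular_W_iff {d e : ℤ} {β ζ : Kq} {a b : ℤ} :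
    IsSingular d e β ζ (P.W a b) ↔
      (P.cPlus a b = 0 ∧ P.cMinus a b = 0) ∧
        d = P.κd - a - b ∧ e = P.κ1 + a + b ∧ β = qbr P.μ (a - b) ∧ ζ = P.zEigenvalue a b := by
  have hW := P.isWeightVector_W a b
  have cancel {s t : Kq} (h : s • P.W a b = t • P.W a b) : s = t :=
    smul_left_injective Kq (P.W_ne_zero a b) h
  constructor
  · intro h
    have hc := P.B1_smul_W_eq_zero_iff.mp h.b1
    exact ⟨hc, q_zpow_injective (cancel (h.dd.symm.trans hW.dd)),
      q_zpow_injective (cancel (h.d1.symm.trans hW.d1)), cancel (h.b0.symm.trans hW.b0),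
      cancel (h.z.symm.trans (P.Z_smul_W hc.1 hc.2))⟩
  · rintro ⟨hc, rfl, rfl, rfl, rfl⟩
    exact ⟨hW, P.B1_smul_W_eq_zero_iff.mpr hc, P.Z_smul_W hc.1 hc.2⟩

theorem zEigenvalue_zero_zero : P.zEigenvalue 0 0 = P.ζ := by
  rw [zEigenvalue, cMinus, b1Coeff, zero_add, sub_self, zero_sub, singularZeta, zero_add,
    qint_one, one_mul, neg_div (R := Kq), mul_div_cancel_left₀ _ (P.qplus_ne_zero _)]
  simp [qint_zero]

variable {P}

theorem cMinus_add_one_eq {j : ℤ} (hj : P.ζ = singularZeta P.κ P.μ j) (a b : ℤ) :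
    P.cMinus a (b + 1) =
      -(qint (b + 1) * qplus P.μ (-(b + 1)) * (qint (b - j) * qplus P.μ (P.κ - j - b)) /
        qplus P.μ (a - (b + 1))) := by
  rw [cMinus, b1Coeff, hj, singularZeta_sub _ P.μ_ne_zero, add_sub_cancel_right, neg_div (R := Kq)]

theorem zEigenvalue_zero_left {i : ℤ} (hi : P.ζ = singularZeta P.κ P.μ i) :
    P.zEigenvalue 0 (i + 1) = P.μ * q * qint (P.κ - i)
      + P.μ⁻¹ * q ^ (2 * i + 1 - P.κ) * qint (i + 2) := by
  have hμ := P.μ_ne_zero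
  have hq := q_ne_zero
  have h := q_sq_sub_one_ne_zero
  have hc : P.cMinus 0 (i + 1 + 1) = -(qint (i + 2) * qplus P.μ (P.κ - 2 * i - 1)) := by
    have hne := P.qplus_ne_zero (-(i + 2))
    rw [cMinus_add_one_eq hi, add_sub_cancel_left, qint_one, one_mul, zero_sub,
      show i + 1 + 1 = i + 2 by ring, show P.κ - i - (i + 1) = P.κ - 2 * i - 1 by ring,
      mul_right_comm, mul_div_cancel_right₀ _ hne]
  rw [zEigenvalue, hc]
  simp only [qint, qplus, two_mul, neg_add, neg_sub, zpow_add₀ hq, zpow_sub₀ hq, zpow_neg,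
    zpow_ofNat]
  field_simp
  ring

theorem zEigenvalue_zero_right {i : ℤ} (hi : P.ζ = singularZeta P.κ P.μ (P.κ - i)) :
    P.zEigenvalue (i + 1) 0 = -(P.μ * q ^ (2 * i + 1 - P.κ) * qint (i + 2))
      - P.μ⁻¹ * q * qint (P.κ - i) := by
  have hμ := P.μ_ne_zero
  have hq := q_ne_zero
  have h := q_sq_sub_one_ne_zero
  have hc : P.cMinus (i + 1) (0 + 1) = -(qplus P.μ (-1) * qint (i - P.κ)) := by
    have hne := P.qplus_ne_zero i
    rw [cMinus_add_one_eq hi, zero_add, qint_one, one_mul, add_sub_cancel_right, sub_sub_cancel,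
      sub_zero, zero_sub, neg_sub, ← mul_assoc, mul_div_cancel_right₀ _ hne]
  rw [zEigenvalue, hc]
  simp only [qint, qplus, two_mul, neg_sub, zpow_add₀ hq, zpow_sub₀ hq, zpow_neg,
    zpow_ofNat, add_zero]
  field_simp
  ring

theorem zEigenvalue_corner {i : ℤ} (hi : P.ζ = singularZeta P.κ P.μ i) :
    P.zEigenvalue (P.κ - i + 1) (i + 1) = P.μ⁻¹ * q ^ (i + 2) * qint (i + 2)
      - P.μ * q ^ (P.κ - i + 2) * qint (P.κ - i + 2) := by
  have hμ := P.μ_ne_zero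
  have hq := q_ne_zero
  have h := q_sq_sub_one_ne_zero
  have hc : P.cMinus (P.κ - i + 1) (i + 1 + 1) = -(qint (i + 2) * qplus P.μ (-(i + 2))) := by
    have hne := P.qplus_ne_zero (P.κ - 2 * i - 1)
    rw [cMinus_add_one_eq hi, add_sub_cancel_left, qint_one, one_mul,
      show i + 1 + 1 = i + 2 by ring, show P.κ - i - (i + 1) = P.κ - 2 * i - 1 by ring,
      show P.κ - i + 1 - (i + 2) = P.κ - 2 * i - 1 by ring, mul_div_cancel_right₀ _ hne]
  rw [zEigenvalue, hc]
  simp only [qint, qplus, two_mul, neg_add, neg_neg, neg_sub, zpow_add₀ hq, zpow_sub₀ hq, zpow_neg,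
    zpow_ofNat]
  field_simp
  ring

end GoodWeight

namespace GoodWeight

variable (P : GoodWeight)

/-- The Verma module with the highest weight `P`. -/
abbrev GoodVerma : Type := Verma P.κd P.κ1 (qbr P.μ 0) P.ζ

/-- The highest weight vector of the Verma module with the highest weight `P`. -/
abbrev highest : P.GoodVerma := highestVector P.κd P.κ1 (qbr P.μ 0) P.ζ

theorem isSingular_W_zero_zero : IsSingular P.κd P.κ1 (qbr P.μ 0) P.ζ (P.W 0 0) :=
  P.isSingular_W_iff.mpr ⟨⟨P.cPlus_eq_zero_iff.mpr (.inl rfl), P.cMinus_eq_zero_iff.mpr (.inl rfl)⟩,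
    by ring, by ring, by rw [sub_zero], P.zEigenvalue_zero_zero.symm⟩

/-- The embedding of the Verma module into the lattice representation. -/
def toLattice : P.GoodVerma →ₗ[Uq'] P.Lattice := vermaLift P.isSingular_W_zero_zero

theorem toLattice_descendant (a b : ℕ) :
    P.toLattice (descendant P.μ P.highest a b) = P.W a b := by
  rw [map_descendant, toLattice, vermaLift_highestVector, descendant_W]

theorem linearIndependent_W : LinearIndependent Kq fun p : ℕ × ℕ => P.W p.1 p.2 :=
  P.latticeBasis.linearIndependent.comp (fun p : ℕ × ℕ => ((p.1 : ℤ), (p.2 : ℤ)))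
    (Nat.cast_injective.prodMap Nat.cast_injective)

/-- The descendants of the highest weight vector, as a basis of the Verma module. -/
def descendantBasis : Module.Basis (ℕ × ℕ) Kq P.GoodVerma :=
  .mk (v := fun p : ℕ × ℕ => descendant P.μ P.highest p.1 p.2)
    (.of_comp (P.toLattice.restrictScalars Kq) <| by
      convert P.linearIndependent_W using 2 with p
      exact P.toLattice_descendant p.1 p.2)
    (descendantSpan_highestVector P.μ_ne_zero P.isGood P.κd P.κ1 P.ζ).ge

theorem descendantBasis_apply (p : ℕ × ℕ) :
    P.descendantBasis p = descendant P.μ P.highest p.1 p.2 :=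
  Module.Basis.mk_apply ..

theorem toLattice_injective : Function.Injective P.toLattice := by
  have h : P.descendantBasis.constr Kq (fun p => P.W p.1 p.2) = P.toLattice.restrictScalars Kq :=
    P.descendantBasis.ext fun p => by
      rw [Module.Basis.constr_basis, LinearMap.restrictScalars_apply, descendantBasis_apply,
        toLattice_descendant]
  intro x y hxy
  refine P.descendantBasis.repr.injective (P.linearIndependent_W ?_)
  have h' (z : P.GoodVerma) := LinearMap.congr_fun h z
  simp only [Module.Basis.constr_apply, Finsupp.linearCombination_apply] at h' ⊢
  exact (h' x).trans (hxy.trans (h' y).symm)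

theorem isWeightVector_descendantBasis (p : ℕ × ℕ) :
    IsWeightVector (P.κd - p.1 - p.2) (P.κ1 + p.1 + p.2) (qbr P.μ (p.1 - p.2))
      (P.descendantBasis p) := by
  rw [descendantBasis_apply]
  exact isWeightVector_descendant P.μ_ne_zero (highestVector_isSingular ..).toIsWeightVector ..

theorem repr_smul_eq {A : Uq'} {c : ℕ × ℕ → Kq}
    (h : ∀ p, A • P.descendantBasis p = c p • P.descendantBasis p) (x : P.GoodVerma) (p : ℕ × ℕ) :
    P.descendantBasis.repr (A • x) p = c p * P.descendantBasis.repr x p := by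
  have hlin : P.descendantBasis.coord p ∘ₗ Algebra.lsmul Kq Kq _ A =
      c p • P.descendantBasis.coord p :=
    P.descendantBasis.ext fun p' => by
      simp +contextual [h, Finsupp.single_apply]
  exact LinearMap.congr_fun hlin x

variable {P} {d e : ℤ} {β ζ : Kq} {x y : P.GoodVerma}

theorem weight_eq_of_repr_ne_zero (hx : IsWeightVector d e β x) {p : ℕ × ℕ}
    (hp : P.descendantBasis.repr x p ≠ 0) : d = P.κd - p.1 - p.2 ∧ β = qbr P.μ (p.1 - p.2) := by
  have cancel {A : Uq'} {s : Kq} {c : ℕ × ℕ → Kq} (hA : A • x = s • x)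
      (h : ∀ p, A • P.descendantBasis p = c p • P.descendantBasis p) : s = c p := by
    have hr := P.repr_smul_eq h x p
    rw [hA, map_smul, Finsupp.smul_apply, smul_eq_mul] at hr
    exact mul_right_cancel₀ hp hr
  exact ⟨q_zpow_injective (cancel hx.dd fun p => (P.isWeightVector_descendantBasis p).dd),
    cancel hx.b0 fun p => (P.isWeightVector_descendantBasis p).b0⟩

theorem eq_repr_smul_of_repr_ne_zero (hx : IsWeightVector d e β x) (hy : IsWeightVector d e β y)
    {p : ℕ × ℕ} (hp : P.descendantBasis.repr y p ≠ 0) :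
    x = P.descendantBasis.repr x p • P.descendantBasis p := by
  obtain ⟨hd, hβ⟩ := weight_eq_of_repr_ne_zero hy hp
  refine P.descendantBasis.ext_elem fun p' => ?_
  by_cases hpp' : p' = p
  · simp [hpp']
  · rw [map_smul, Module.Basis.repr_self, Finsupp.smul_single, Finsupp.single_eq_of_ne hpp']
    by_contra hp'
    obtain ⟨hd', hβ'⟩ := weight_eq_of_repr_ne_zero hx hp'
    have hn := qbr_injective P.μ_ne_zero P.isGood (hβ.symm.trans hβ')
    exact hpp' (Prod.ext (by omega) (by omega))

theorem exists_repr_ne_zero (hx : x ≠ 0) : ∃ p, P.descendantBasis.repr x p ≠ 0 := by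
  by_contra! h
  exact hx (P.descendantBasis.ext_elem fun p => by rw [h, map_zero, Finsupp.zero_apply])

theorem exists_smul_eq_of_isWeightVector (hx : IsWeightVector d e β x) (hx0 : x ≠ 0)
    (hy : IsWeightVector d e β y) : ∃ c : Kq, c • x = y := by
  obtain ⟨p, hp⟩ := exists_repr_ne_zero hx0
  refine ⟨P.descendantBasis.repr y p * (P.descendantBasis.repr x p)⁻¹, ?_⟩
  have hxp := eq_repr_smul_of_repr_ne_zero hx hx hp
  have hyp := eq_repr_smul_of_repr_ne_zero hy hx hp
  have hinv : (P.descendantBasis.repr x p)⁻¹ • x = P.descendantBasis p :=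
    (inv_smul_eq_iff₀ (β := P.GoodVerma) hp).mpr hxp
  exact (mul_smul (α := Kq) (β := P.GoodVerma) _ _ x).trans ((congrArg _ hinv).trans hyp.symm)

theorem exists_hom_ne_zero_iff :
    (∃ φ : Verma d e β ζ →ₗ[Uq'] P.GoodVerma, φ ≠ 0) ↔
      ∃ a b : ℕ, IsSingular d e β ζ (P.W a b) := by
  constructor
  · rintro ⟨φ, hφ⟩
    have hx := (highestVector_isSingular d e β ζ).map φ
    obtain ⟨p, hp⟩ := exists_repr_ne_zero (map_highestVector_ne_zero hφ)
    have hxp := eq_repr_smul_of_repr_ne_zero hx.toIsWeightVector hx.toIsWeightVector hp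
    have hbasis := hx.smul (P.descendantBasis.repr (φ (highestVector d e β ζ)) p)⁻¹
    rw [(inv_smul_eq_iff₀ hp).mpr hxp] at hbasis
    have hW := hbasis.map P.toLattice
    rw [descendantBasis_apply, toLattice_descendant] at hW
    exact ⟨p.1, p.2, hW⟩
  · rintro ⟨a, b, h⟩
    rw [← toLattice_descendant] at h
    refine ⟨vermaLift (h.of_map P.toLattice_injective), fun h0 => P.W_ne_zero a b ?_⟩
    rw [← toLattice_descendant, ← vermaLift_highestVector (h.of_map P.toLattice_injective), h0,
      LinearMap.zero_apply, map_zero]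

theorem finrank_hom_eq_one (h : ∃ φ : Verma d e β ζ →ₗ[Uq'] P.GoodVerma, φ ≠ 0) :
    Module.finrank Kq (Verma d e β ζ →ₗ[Uq'] P.GoodVerma) = 1 := by
  obtain ⟨φ, hφ⟩ := h
  have hv := highestVector_isSingular d e β ζ
  refine (finrank_eq_one_iff_of_nonzero' φ hφ).mpr fun ψ => ?_
  obtain ⟨c, hc⟩ := exists_smul_eq_of_isWeightVector (hv.map φ).toIsWeightVector
    (map_highestVector_ne_zero hφ) (hv.map ψ).toIsWeightVector
  exact ⟨c, verma_hom_ext hc⟩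

theorem isSingular_W_zero_zero_iff :
    IsSingular d e β ζ (P.W 0 0) ↔ d = P.κd ∧ e = P.κ1 ∧ β = qbr P.μ 0 ∧ ζ = P.ζ := by
  rw [isSingular_W_iff, cPlus_eq_zero_iff, cMinus_eq_zero_iff, zEigenvalue_zero_zero]
  simp

theorem isSingular_W_zero_left_iff {i : ℤ} (hi : i + 1 ≠ 0) :
    IsSingular d e β ζ (P.W 0 (i + 1)) ↔
      P.ζ = singularZeta P.κ P.μ i ∧ d = P.κd - i - 1 ∧ e = P.κ1 + i + 1 ∧
        β = qbr P.μ (-(i + 1)) ∧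
        ζ = P.μ * q * qint (P.κ - i) + P.μ⁻¹ * q ^ (2 * i + 1 - P.κ) * qint (i + 2) := by
  simp only [isSingular_W_iff, cPlus_eq_zero_iff, cMinus_eq_zero_iff, hi, true_or,
    true_and, false_or, add_sub_cancel_right, sub_zero, add_zero, zero_sub, sub_add_eq_sub_sub P.κd,
    ← add_assoc]
  exact and_congr_right fun h => by rw [zEigenvalue_zero_left h]

theorem isSingular_W_zero_right_iff {i : ℤ} (hi : i + 1 ≠ 0) :
    IsSingular d e β ζ (P.W (i + 1) 0) ↔
      P.ζ = singularZeta P.κ P.μ (P.κ - i) ∧ d = P.κd - i - 1 ∧ e = P.κ1 + i + 1 ∧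
        β = qbr P.μ (i + 1) ∧
        ζ = -(P.μ * q ^ (2 * i + 1 - P.κ) * qint (i + 2)) - P.μ⁻¹ * q * qint (P.κ - i) := by
  simp only [isSingular_W_iff, cPlus_eq_zero_iff, cMinus_eq_zero_iff, hi, true_or,
    and_true, false_or, add_sub_cancel_right, sub_zero, add_zero, sub_add_eq_sub_sub, ← add_assoc]
  exact and_congr_right fun h => by rw [zEigenvalue_zero_right h]

theorem isSingular_W_corner_iff {i j : ℤ} (hi : i + 1 ≠ 0) (hj : j + 1 ≠ 0) :
    IsSingular d e β ζ (P.W (j + 1) (i + 1)) ↔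
      j = P.κ - i ∧ P.ζ = singularZeta P.κ P.μ i ∧ d = P.κ1 - 2 ∧ e = P.κd + 2 ∧
        β = qbr P.μ (P.κ - 2 * i) ∧
        ζ = P.μ⁻¹ * q ^ (i + 2) * qint (i + 2) -
          P.μ * q ^ (P.κ - i + 2) * qint (P.κ - i + 2) := by
  rw [isSingular_W_iff, cPlus_eq_zero_iff, cMinus_eq_zero_iff, or_iff_right hi, or_iff_right hj,
    add_sub_cancel_right, add_sub_cancel_right]
  have hcorner : (P.ζ = singularZeta P.κ P.μ (P.κ - j) ∧ P.ζ = singularZeta P.κ P.μ i) ↔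
      j = P.κ - i ∧ P.ζ = singularZeta P.κ P.μ i := by
    refine and_congr_left fun h => ?_
    rw [h, (singularZeta_injective P.κ P.μ_ne_zero P.isGood).eq_iff]
    omega
  rw [hcorner, and_assoc]
  refine and_congr_right ?_
  rintro rfl
  refine and_congr_right fun h => ?_
  have hκ : P.κ = P.κd - P.κ1 := rfl
  rw [zEigenvalue_corner h, show P.κd - (P.κ - i + 1) - (i + 1) = P.κ1 - 2 by omega,
    show P.κ1 + (P.κ - i + 1) + (i + 1) = P.κd + 2 by omega,
    show P.κ - i + 1 - (i + 1) = P.κ - 2 * i by omega]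

theorem exists_isSingular_W_iff :
    (∃ a b : ℕ, IsSingular d e β ζ (P.W a b)) ↔
      ∃ i : ℕ,
        IsSingular d e β ζ (P.W 0 (i + 1)) ∨ IsSingular d e β ζ (P.W (i + 1) 0) ∨
        ((i : ℤ) ≤ P.κ ∧ IsSingular d e β ζ (P.W (P.κ - i + 1) (i + 1))) ∨
        IsSingular d e β ζ (P.W 0 0) := by
  constructor
  · rintro ⟨_ | a, _ | b, h⟩
    · exact ⟨0, .inr (.inr (.inr h))⟩
    · exact ⟨b, .inl h⟩
    · exact ⟨a, .inr (.inl h)⟩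
    · push_cast at h
      have ha := ((isSingular_W_corner_iff (by omega) (by omega)).mp h).1
      exact ⟨b, .inr (.inr (.inl ⟨by omega, ha ▸ h⟩))⟩
  · rintro ⟨i, h | h | ⟨hi, h⟩ | h⟩
    · exact ⟨0, i + 1, h⟩
    · exact ⟨i + 1, 0, h⟩
    · lift P.κ - i to ℕ using sub_nonneg.mpr hi with a
      exact ⟨a + 1, i + 1, h⟩
    · exact ⟨0, 0, h⟩

end GoodWeight

end

end QSP

theorem theorem4p12_general (κd κ1 κd' κ1' : ℤ) (μ ζ β' ζ' : QSP.Kq)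
    (hμ : μ ≠ 0) (hgood : QSP.IsGood μ) (κ : ℤ) (hκ : κ = κd - κ1) :
    ((∃ φ : QSP.VermaHom κd' κ1' β' ζ' κd κ1 (QSP.qbr μ 0) ζ, φ ≠ 0) ↔
      ∃ i : ℕ,
        (ζ = μ * QSP.q ^ (-(i : ℤ)) * QSP.qint (κ - i)
              - μ⁻¹ * QSP.q ^ ((i : ℤ) - κ) * QSP.qint i ∧
          κd' = κd - i - 1 ∧
          κ1' = κ1 + i + 1 ∧
          β' = QSP.qbr μ (-((i : ℤ) + 1)) ∧
          ζ' = μ * QSP.q * QSP.qint (κ - i)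
              + μ⁻¹ * QSP.q ^ (2 * (i : ℤ) + 1 - κ) * QSP.qint (i + 2)) ∨
        (ζ = μ * QSP.q ^ ((i : ℤ) - κ) * QSP.qint i
              - μ⁻¹ * QSP.q ^ (-(i : ℤ)) * QSP.qint (κ - i) ∧
          κd' = κd - i - 1 ∧
          κ1' = κ1 + i + 1 ∧
          β' = QSP.qbr μ ((i : ℤ) + 1) ∧
          ζ' = -(μ * QSP.q ^ (2 * (i : ℤ) + 1 - κ) * QSP.qint (i + 2))
              - μ⁻¹ * QSP.q * QSP.qint (κ - i)) ∨
        ((i : ℤ) ≤ κ ∧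
          ζ = μ * QSP.q ^ (-(i : ℤ)) * QSP.qint (κ - i)
              - μ⁻¹ * QSP.q ^ ((i : ℤ) - κ) * QSP.qint i ∧
          κd' = κ1 - 2 ∧
          κ1' = κd + 2 ∧
          β' = QSP.qbr μ (κ - 2 * i) ∧
          ζ' = μ⁻¹ * QSP.q ^ ((i : ℤ) + 2) * QSP.qint (i + 2)
              - μ * QSP.q ^ (κ - i + 2) * QSP.qint (κ - i + 2)) ∨
        (κd' = κd ∧ κ1' = κ1 ∧ β' = QSP.qbr μ 0 ∧ ζ' = ζ)) ∧
    ((∃ φ : QSP.VermaHom κd' κ1' β' ζ' κd κ1 (QSP.qbr μ 0) ζ, φ ≠ 0) →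
      Module.finrank QSP.Kq
        (QSP.VermaHom κd' κ1' β' ζ' κd κ1 (QSP.qbr μ 0) ζ) = 1) := by
  subst hκ
  let P : QSP.GoodWeight := ⟨κd, κ1, μ, ζ, hμ, hgood⟩
  refine ⟨?_, QSP.GoodWeight.finrank_hom_eq_one (P := P)⟩
  refine (QSP.GoodWeight.exists_hom_ne_zero_iff (P := P)).trans ?_
  refine QSP.GoodWeight.exists_isSingular_W_iff.trans (exists_congr fun i => ?_)
  have hi : (i : ℤ) + 1 ≠ 0 := by omega
  refine or_congr ?_ (or_congr ?_ (or_congr (and_congr_right fun (hiκ : i ≤ κd - κ1) => ?_) ?_))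
  · exact QSP.GoodWeight.isSingular_W_zero_left_iff hi
  · rw [QSP.GoodWeight.isSingular_W_zero_right_iff hi, QSP.singularZeta, sub_sub_cancel, neg_sub,
      sub_sub_cancel_left]
    exact Iff.rfl
  · have hj : κd - κ1 - i + 1 ≠ 0 := by omega
    exact (QSP.GoodWeight.isSingular_W_corner_iff hi hj).trans (and_iff_right rfl)
  · exact QSP.GoodWeight.isSingular_W_zero_zero_iff

theorem theorem4p12 (κd κ1 κd' κ1' : ℤ) (μ ζ μ' ζ' : QSP.Kq)
    (hμ : μ ≠ 0) (hμ' : μ' ≠ 0) (hgood : QSP.IsGood μ) (κ : ℤ) (hκ : κ = κd - κ1) :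
    ((∃ φ : QSP.VermaHom κd' κ1' (QSP.qbr μ' 0) ζ' κd κ1 (QSP.qbr μ 0) ζ, φ ≠ 0) ↔
      ∃ i : ℕ,
        -- first case
        (ζ = μ * QSP.q ^ (-(i : ℤ)) * QSP.qint (κ - i)
              - μ⁻¹ * QSP.q ^ ((i : ℤ) - κ) * QSP.qint i ∧
          κd' = κd - i - 1 ∧
          κ1' = κ1 + i + 1 ∧
          QSP.qbr μ' 0 = QSP.qbr μ (-((i : ℤ) + 1)) ∧
          ζ' = μ * QSP.q * QSP.qint (κ - i)
              + μ⁻¹ * QSP.q ^ (2 * (i : ℤ) + 1 - κ) * QSP.qint (i + 2)) ∨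
        -- second case
        (ζ = μ * QSP.q ^ ((i : ℤ) - κ) * QSP.qint i
              - μ⁻¹ * QSP.q ^ (-(i : ℤ)) * QSP.qint (κ - i) ∧
          κd' = κd - i - 1 ∧
          κ1' = κ1 + i + 1 ∧
          QSP.qbr μ' 0 = QSP.qbr μ ((i : ℤ) + 1) ∧
          ζ' = -(μ * QSP.q ^ (2 * (i : ℤ) + 1 - κ) * QSP.qint (i + 2))
              - μ⁻¹ * QSP.q * QSP.qint (κ - i)) ∨
        -- third case
        ((i : ℤ) ≤ κ ∧
          ζ = μ * QSP.q ^ (-(i : ℤ)) * QSP.qint (κ - i)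
              - μ⁻¹ * QSP.q ^ ((i : ℤ) - κ) * QSP.qint i ∧
          κd' = κ1 - 2 ∧
          κ1' = κd + 2 ∧
          QSP.qbr μ' 0 = QSP.qbr μ (κ - 2 * i) ∧
          ζ' = μ⁻¹ * QSP.q ^ ((i : ℤ) + 2) * QSP.qint (i + 2)
              - μ * QSP.q ^ (κ - i + 2) * QSP.qint (κ - i + 2)) ∨
        -- fourth case: the two highest weights agree
        (κd' = κd ∧ κ1' = κ1 ∧ QSP.qbr μ' 0 = QSP.qbr μ 0 ∧ ζ' = ζ)) ∧
    ((∃ φ : QSP.VermaHom κd' κ1' (QSP.qbr μ' 0) ζ' κd κ1 (QSP.qbr μ 0) ζ, φ ≠ 0) →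
      Module.finrank QSP.Kq
        (QSP.VermaHom κd' κ1' (QSP.qbr μ' 0) ζ' κd κ1 (QSP.qbr μ 0) ζ) = 1) :=
  theorem4p12_general κd κ1 κd' κ1' μ ζ (QSP.qbr μ' 0) ζ' hμ hgood κ hκ
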